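/- Let $c\ge 1$ be an integer and let $\gamma>0$. There are constants $K,\kappa>0$, depending only on $c$ and $\gamma$, such that the following holds. Let $\Sigma$ be a finite alphabet, $m=2^\ell$ with $\ell\ge 0$ an integer, identify $[m]=\{0,\dots,m-1\}$ with the bit strings of length $\ell$, and let $h\colon\Sigma^c\to[m]$ be a simple tabulation hash function, that is, $h(x_1,\dots,x_c)=h_1(x_1)\oplus\cdots\oplus h_c(x_c)$, where $h_1,\dots,h_c\colon\Sigma\to[m]$ are independent, uniformly random functions and $\oplus$ is bitwise XOR. Let $S\subseteq\Sigma^c$ with $n=|S|$, let $w_x\in[0,1]$ for $x\in S$, let $y\in[m]$, and let $X=\sum_{x\in S}w_x\cdot[h(x)=y]$ be the total weight of the keys that hash to the bin $y$. Write $\mu=\mathbb{E}[X]$, $\sigma^2=\mathrm{Var}[X]$ and $\mathcal{C}(x)=(x+1)\ln(x+1)-x$. Then for every $t>0$, $$\Pr\left[|X-\mu|\ge t\right]\le K\exp\left(-\kappa\,\sigma^2\,\mathcal{C}(t/\sigma^2)\right)+\frac{n}{m^\gamma}$$ (if $\sigma^2=0$, the left-hand side is $0$). Furthermore, this concentration is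 query invariant: for every $q\in\Sigma^c$ and every $z\in[m]$, the same bound, with constants depending only on $c$ and $\gamma$, holds when $h$ is conditioned on $h(q)=z$, where the probability, $\mu$ and $\sigma^2$ are then those under the conditional distribution. -/

import Mathlib

open MeasureTheory ProbabilityTheory

noncomputable section

/-- The hash range `[m]` with `m = 2 ^ ℓ`, identified with the bit strings of length `ℓ`.
A bit is an element of `ZMod 2`, so that the addition `+` is the bitwise XOR. -/
abbrev HashValue (ℓ : ℕ) : Type := Fin ℓ → ZMod 2

/-- A choice of `c` character tables, the `j`-th one mapping characters of the alphabet `A`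
to `ℓ`-bit hash values. -/
def CharTables (c : ℕ) (A : Type*) (ℓ : ℕ) : Type _ := Fin c → A → HashValue ℓ

/-- Every set of character tables is an event. -/
instance (c : ℕ) (A : Type*) (ℓ : ℕ) : MeasurableSpace (CharTables c A ℓ) := ⊤

/-- Fully random character tables: the uniform distribution on all choices of the tables. -/
def tableMeasure (c : ℕ) (A : Type*) (ℓ : ℕ) : Measure (CharTables c A ℓ) :=
  uniformOn Set.univ

/-- The simple tabulation hash function of the tables `T`: the key `x = (x₁, …, x_c)` is hashed
to the bitwise XOR of the table entries `T₁(x₁), …, T_c(x_c)`. -/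
def simpleTabulation {c : ℕ} {A : Type*} {ℓ : ℕ} (T : CharTables c A ℓ) (x : Fin c → A) :
    HashValue ℓ :=
  ∑ j, T j (x j)

/-- The total weight of the keys `x ∈ S` that the hash function `h` maps to the bin `y`. -/
def binWeight {U R : Type*} [DecidableEq R] (S : Finset U) (w : U → ℝ) (y : R) (h : U → R) : ℝ :=
  ∑ x ∈ S, w x * (if h x = y then 1 else 0)

/-- The function `𝒞(x) = (x + 1) ln (x + 1) - x` of Bennett's inequality. -/
def bennettC (x : ℝ) : ℝ := (x + 1) * Real.log (x + 1) - x

/-- Under the law `P`, the random variable `X` is strongly concentrated with additive error `err`,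
where `K` and `κ` are the constants hidden in the `O` and in the `Ω` respectively.
(If the variance is zero then the probability on the left is zero.) -/
def StronglyConcentrated {Ω : Type*} [MeasurableSpace Ω] (P : Measure Ω) (X : Ω → ℝ)
    (K κ err : ℝ) : Prop :=
  ∀ t : ℝ, 0 < t →
    P.real {ω | t ≤ |X ω - ∫ ω', X ω' ∂P|} ≤
      K * Real.exp (-(κ * (variance X P * bennettC (t / variance X P)))) + err

/-- The property `prop`, which depends on the law of the randomness of the hash function `h`, holds
after conditioning on `h(q) = z`, for every query key `q` and every hash value `z`. -/
def HoldsForAllQueries {Ω U R : Type*} [MeasurableSpace Ω] (P : Measure Ω) (h : Ω → U → R)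
    (prop : Measure Ω → Prop) : Prop :=
  ∀ (q : U) (z : R), prop (cond P {ω | h ω q = z})

end

/-! A position is a pair of a coordinate and a character. Order the positions and reveal the table
entries one by one. A key is settled when its last position `α` is revealed. The keys with last
position `α`, with `α` erased, form the family `link`, and the uniform entry `T α` merely translates
their bin weights. So the deviation `bias` of a bin is a sum of martingale differences, one per
position: each is bounded by the largest deviation in the link, and its conditional variance is the
`energy` of the link divided by the number `m` of bins. Freedman's inequality (`fraction_sum_le`)
gives a Bennett-type tail once all links have energy O(mass) and bounded deviations, outside an
event of probability about n/m^γ. Both facts follow by induction on the number of positions per key;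
masses and key counts of the links add up to at most those of the family, so union bounds over links
are cheap.

Energy (`fraction_energy_le`): revealing `α` adds the energy of the link plus a cross term, which is
a martingale difference. If the link has small nontrivial Fourier coefficients
(`fraction_coeff_le`), its translates are nearly orthogonal to the earlier deviations on average
(`sum_correlation_sq_le`), so the cross term has small variance. This variance also involves the
energy being bounded, a circularity broken by stopping when the energy first exceeds its target.
Deviations (`fraction_bias_le`): they are bounded in all bins at once if the mass is at most
m^(1-ε).

To meet that mass condition, `exists_rank` orders the positions so that all links are light: mass at
most k W^(1-1/k) for keys of at most k positions and total mass W. If this is still too heavy, W is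
so large that the weaker bounds on the links give a Gaussian tail up to a deviation whose
probability is already exp(-Ω(m^ε)), which the additive error absorbs.

Conditioning on h(q) = z leaves the uniform law on a set of tables that is invariant under changing
entries off q. On each orbit of such changes the other keys have the same mean and variance, and q
contributes a constant. Hence `stronglyConcentrated_uniformOn` covers both the plain and the
conditioned law. -/

open Function Filter

/-! ### Uniform probability on a finite type -/

/-- The fraction of the elements of a finite type that satisfy `p`. -/
noncomputable def fraction {Ω : Type*} [Fintype Ω] (p : Ω → Prop) : ℝ :=
  open Classical in ((Finset.univ.filter p).card : ℝ) / Fintype.card Ω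

section Fraction

variable {Ω : Type*} [Fintype Ω]

theorem fraction_le_one (p : Ω → Prop) : fraction p ≤ 1 := by
  classical
  unfold fraction
  refine div_le_one_of_le₀ ?_ (by positivity)
  exact_mod_cast Finset.card_le_univ _

theorem fraction_mono {p q : Ω → Prop} (h : ∀ T, p T → q T) : fraction p ≤ fraction q := by
  classical
  unfold fraction
  gcongr ?_ / _
  refine Nat.cast_le.2 (Finset.card_le_card fun T hT => ?_)
  simp only [Finset.mem_filter, Finset.mem_univ, true_and] at hT ⊢
  exact h T hT

theorem fraction_eq_zero {p : Ω → Prop} (h : ∀ T, ¬ p T) : fraction p = 0 := by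
  classical
  unfold fraction
  simp [h]

theorem fraction_or_le (p q : Ω → Prop) :
    fraction (fun T => p T ∨ q T) ≤ fraction p + fraction q := by
  classical
  unfold fraction
  rw [← add_div]
  gcongr
  refine (Nat.cast_le.2 (Finset.card_le_card (t := Finset.univ.filter p ∪ Finset.univ.filter q)
    fun T hT => ?_)).trans (by exact_mod_cast Finset.card_union_le _ _)
  simpa using hT

theorem fraction_exists_le {ι : Type*} (s : Finset ι) (p : ι → Ω → Prop) :
    fraction (fun T => ∃ i ∈ s, p i T) ≤ ∑ i ∈ s, fraction (p i) := by
  classical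
  induction s using Finset.induction_on with
  | empty => simp [fraction_eq_zero]
  | insert a s ha ih =>
    rw [Finset.sum_insert ha]
    refine le_trans (fraction_mono (q := fun T => p a T ∨ ∃ i ∈ s, p i T) ?_)
      ((fraction_or_le _ _).trans (by gcongr))
    simp

/-- The exponential Markov inequality. -/
theorem fraction_le_exp_mul (X : Ω → ℝ) (t : ℝ) :
    fraction (fun T => t ≤ X T) ≤
      Real.exp (-t) * ((∑ T, Real.exp (X T)) / Fintype.card Ω) := by
  classical
  unfold fraction
  rw [← mul_div_assoc]
  gcongr
  rw [Finset.mul_sum, Finset.card_filter, Nat.cast_sum]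
  refine Finset.sum_le_sum fun T _ => ?_
  split_ifs with h
  · rw [← Real.exp_add]
    have := Real.one_le_exp (x := -t + X T) (by linarith)
    simpa using this
  · simp only [Nat.cast_zero]; positivity

end Fraction

/-! ### Martingales that reveal table entries in order of rank -/

section Tables

variable {I H : Type*} [Fintype I] [DecidableEq I] [AddCommGroup H] [Fintype H]

/-- Averaging over the entry of one position does not change the sum over all tables. -/
theorem sum_sum_update (α : I) (Φ : (I → H) → ℝ) :
    ∑ T : I → H, ∑ u, Φ (update T α u) = Fintype.card H * ∑ T, Φ T := by
  have h1 (T : I → H) : ∑ u, Φ (update T α u) = ∑ v, Φ (T + Pi.single α v) := by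
    symm
    refine Fintype.sum_equiv (Equiv.addLeft (T α)) _ _ fun v => ?_
    congr 1
    ext β
    by_cases hβ : β = α
    · subst hβ; simp
    · simp [hβ]
  simp_rw [h1]
  rw [Finset.sum_comm]
  have h2 (v : H) : ∑ T : I → H, Φ (T + Pi.single α v) = ∑ T, Φ T :=
    Fintype.sum_equiv (Equiv.addRight (Pi.single α v)) _ _ fun T => rfl
  simp [h2]

/-- The moment generating function of a sum of adapted terms. -/
theorem sum_exp_sum_le (r : I → ℕ) (hr : Injective r) (D : I → (I → H) → ℝ) (a : I → ℝ)
    (adapted : ∀ α β T u, r β < r α → D β (update T α u) = D β T)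
    (hD : ∀ α T, ∑ u, Real.exp (D α (update T α u)) ≤ Fintype.card H * Real.exp (a α)) :
    ∑ T, Real.exp (∑ α, D α T) ≤ Fintype.card (I → H) * Real.exp (∑ α, a α) := by
  suffices h : ∀ s : Finset I, ∑ T, Real.exp (∑ α ∈ s, D α T) ≤
      Fintype.card (I → H) * Real.exp (∑ α ∈ s, a α) from h _
  intro s
  -- Peel off the position of largest rank: the other terms do not see its entry, so averaging over
  -- that entry alone bounds its factor.
  induction s using Finset.induction_on_max_value r with
  | empty => simp
  | insert α s hα hmax ih =>
    have hpos : (0 : ℝ) < Fintype.card H := by exact_mod_cast Fintype.card_pos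
    simp_rw [Finset.sum_insert hα, Real.exp_add]
    refine le_of_mul_le_mul_left ?_ hpos
    rw [← sum_sum_update α]
    have hs (T : I → H) (u : H) : ∑ β ∈ s, D β (update T α u) = ∑ β ∈ s, D β T :=
      Finset.sum_congr rfl fun β hβ => adapted α β T u <|
        lt_of_le_of_ne (hmax β hβ) fun h => hα (hr h ▸ hβ)
    simp_rw [hs, ← Finset.sum_mul]
    calc ∑ T, (∑ u, Real.exp (D α (update T α u))) * Real.exp (∑ β ∈ s, D β T)
        ≤ ∑ T, (Fintype.card H * Real.exp (a α)) * Real.exp (∑ β ∈ s, D β T) := by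
          gcongr with T _; exact hD α T
      _ = (Fintype.card H * Real.exp (a α)) * ∑ T, Real.exp (∑ β ∈ s, D β T) := by
          rw [Finset.mul_sum]
      _ ≤ (Fintype.card H * Real.exp (a α)) *
            (Fintype.card (I → H) * Real.exp (∑ β ∈ s, a β)) := by gcongr
      _ = _ := by ring

theorem exp_le_quadratic {x y : ℝ} (h : |x| ≤ y) : Real.exp x ≤ 1 + x + x ^ 2 * Real.exp y := by
  have h1 := Complex.norm_exp_sub_sum_le_norm_mul_exp x 2
  have h2 : |Real.exp x - ∑ k ∈ Finset.range 2, x ^ k / k.factorial| ≤ |x| ^ 2 * Real.exp |x| := by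
    rw [Complex.norm_real, Real.norm_eq_abs] at h1
    rw [← Real.norm_eq_abs (Real.exp x - _), ← Complex.norm_real]
    push_cast
    exact h1
  replace h2 := (le_abs_self _).trans h2
  simp only [Finset.sum_range_succ, Finset.sum_range_zero] at h2
  have h3 : x ^ 2 * Real.exp |x| ≤ x ^ 2 * Real.exp y := by gcongr
  norm_num at h2
  linarith

/-- The zero mean kills the linear term of the quadratic bound on the exponential, leaving `1 + z ≤
exp z`. -/
theorem sum_exp_le {g : H → ℝ} {M v s : ℝ} (hM : ∀ u, |g u| ≤ M) (h0 : ∑ u, g u = 0)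
    (hv : ∑ u, g u ^ 2 ≤ Fintype.card H * v) (hs : 0 ≤ s) :
    ∑ u, Real.exp (s * g u) ≤ Fintype.card H * Real.exp (s ^ 2 * Real.exp (s * M) * v) := by
  calc ∑ u, Real.exp (s * g u) ≤ ∑ u, (1 + s * g u + (s * g u) ^ 2 * Real.exp (s * M)) := by
        refine Finset.sum_le_sum fun u _ => exp_le_quadratic ?_
        rw [abs_mul, abs_of_nonneg hs]
        gcongr
        exact hM u
    _ = Fintype.card H + s ^ 2 * Real.exp (s * M) * ∑ u, g u ^ 2 := by
        simp_rw [Finset.sum_add_distrib, ← Finset.mul_sum, h0, mul_pow, ← Finset.sum_mul,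
          ← Finset.mul_sum]
        simp
        ring
    _ ≤ Fintype.card H + s ^ 2 * Real.exp (s * M) * (Fintype.card H * v) := by gcongr
    _ = Fintype.card H * (s ^ 2 * Real.exp (s * M) * v + 1) := by ring
    _ ≤ _ := by gcongr; exact Real.add_one_le_exp _

/-- Freedman's inequality for a martingale that reveals the table entries one by one. -/
theorem fraction_sum_le (r : I → ℕ) (hr : Injective r) (D : I → (I → H) → ℝ) (v : I → ℝ)
    {M V t : ℝ} (hM : 0 < M) (hV : 0 < V) (ht : 0 < t)
    (adapted : ∀ α β T u, r β < r α → D β (update T α u) = D β T)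
    (bounded : ∀ α T, |D α T| ≤ M) (mean : ∀ α T, ∑ u, D α (update T α u) = 0)
    (sq : ∀ α T, ∑ u, D α (update T α u) ^ 2 ≤ Fintype.card H * v α) (hvV : ∑ α, v α ≤ V) :
    fraction (fun T => t ≤ ∑ α, D α T) ≤ Real.exp (-(t / (4 * M) * Real.log (1 + t * M / V))) := by
  set L := Real.log (1 + t * M / V) with hL
  have hr1 : 0 < t * M / V := by positivity
  have hL0 : 0 < L := Real.log_pos (by linarith)
  -- Chosen so that exp(2sM) = 1 + tM/V. Then x ≤ sinh x at x = sM bounds the variance term by half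
  -- of s t, which leaves exponent s t / 2.
  set s := L / (2 * M) with hs
  have hs0 : 0 < s := by positivity
  have key : s ^ 2 * Real.exp (s * M) * V ≤ s * t / 2 := by
    have h1 : s * M ≤ Real.sinh (s * M) := Real.self_le_sinh_iff.2 (by positivity)
    rw [Real.sinh_eq] at h1
    have h2 : Real.exp (s * M) * Real.exp (s * M) = 1 + t * M / V := by
      rw [← Real.exp_add, ← Real.exp_log (show 0 < 1 + t * M / V by positivity), ← hL]
      congr 1
      rw [hs]; field_simp; ring
    have h3 : Real.exp (-(s * M)) * Real.exp (s * M) = 1 := by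
      rw [← Real.exp_add]; simp
    have h4 : s * M * Real.exp (s * M) ≤ t * M / V / 2 := by
      have := mul_le_mul_of_nonneg_right h1 (Real.exp_pos (s * M)).le
      nlinarith
    have h5 : s * Real.exp (s * M) * V ≤ t / 2 := by
      have h6 := mul_le_mul_of_nonneg_right h4 hV.le
      have h7 : t * M / V / 2 * V = M * (t / 2) := by field_simp
      rw [h7] at h6
      refine le_of_mul_le_mul_left (a := M) ?_ hM
      linarith
    have := mul_le_mul_of_nonneg_left h5 hs0.le
    linarith
  have h1 := sum_exp_sum_le r hr (fun α T => s * D α T) (fun α => s ^ 2 * Real.exp (s * M) * v α)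
    (fun α β T u h => by simp only [adapted α β T u h])
    (fun α T => sum_exp_le (fun u => bounded α _) (mean α T) (sq α T) hs0.le)
  have hpos : (0 : ℝ) < Fintype.card (I → H) := by exact_mod_cast Fintype.card_pos
  calc fraction (fun T => t ≤ ∑ α, D α T)
      ≤ fraction (fun T => s * t ≤ ∑ α, s * D α T) := by
        refine fraction_mono fun T hT => ?_
        rw [← Finset.mul_sum]
        gcongr
    _ ≤ Real.exp (-(s * t)) *
          ((∑ T, Real.exp (∑ α, s * D α T)) / Fintype.card (I → H)) := fraction_le_exp_mul _ _
    _ ≤ Real.exp (-(s * t)) * Real.exp (∑ α, s ^ 2 * Real.exp (s * M) * v α) := by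
        gcongr
        rw [div_le_iff₀ hpos, mul_comm]
        exact h1
    _ ≤ _ := by
        rw [← Real.exp_add, ← Finset.mul_sum]
        refine Real.exp_le_exp.2 ?_
        have h2 : s ^ 2 * Real.exp (s * M) * ∑ α, v α ≤ s ^ 2 * Real.exp (s * M) * V := by gcongr
        have h3 : t / (4 * M) * L = s * t / 2 := by rw [hs]; field_simp; ring
        linarith

theorem fraction_abs_sum_le (r : I → ℕ) (hr : Injective r) (D : I → (I → H) → ℝ) (v : I → ℝ)
    {M V t : ℝ} (hM : 0 < M) (hV : 0 < V) (ht : 0 < t)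
    (adapted : ∀ α β T u, r β < r α → D β (update T α u) = D β T)
    (bounded : ∀ α T, |D α T| ≤ M) (mean : ∀ α T, ∑ u, D α (update T α u) = 0)
    (sq : ∀ α T, ∑ u, D α (update T α u) ^ 2 ≤ Fintype.card H * v α) (hvV : ∑ α, v α ≤ V) :
    fraction (fun T => t ≤ |∑ α, D α T|) ≤
      2 * Real.exp (-(t / (4 * M) * Real.log (1 + t * M / V))) := by
  have h1 := fraction_sum_le r hr D v hM hV ht adapted bounded mean sq hvV
  have h2 := fraction_sum_le r hr (fun α T => - D α T) v hM hV ht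
    (fun α β T u h => by simp only [adapted α β T u h])
    (by simpa using bounded) (by simpa using mean) (by simpa using sq) hvV
  refine (fraction_mono fun T hT => ?_).trans
    ((fraction_or_le (fun T => t ≤ ∑ α, D α T) (fun T => t ≤ ∑ α, - D α T)).trans (by linarith))
  rw [Finset.sum_neg_distrib]
  exact le_abs.1 hT

end Tables

/-! ### Fourier analysis on the group of hash values -/

section Characters

/-- The pairing `(-1) ^ (a * b)` of two bits. -/
def bitSign (a b : ZMod 2) : ℝ := if a * b = 1 then -1 else 1

theorem bitSign_add (a b c : ZMod 2) : bitSign a (b + c) = bitSign a b * bitSign a c := by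
  have h : ∀ x : ZMod 2, x = 0 ∨ x = 1 := by decide
  have h2 : (1 : ZMod 2) + 1 = 0 := by decide
  rcases h a with rfl | rfl <;> rcases h b with rfl | rfl <;> rcases h c with rfl | rfl <;>
    simp [bitSign, h2]

theorem bitSign_comm (a b : ZMod 2) : bitSign a b = bitSign b a := by
  simp [bitSign, mul_comm]

theorem sum_bitSign (b : ZMod 2) : ∑ a, bitSign a b = if b = 0 then 2 else 0 := by
  have h : ∀ x : ZMod 2, x = 0 ∨ x = 1 := by decide
  have hu : (Finset.univ : Finset (ZMod 2)) = {0, 1} := by decide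
  rcases h b with rfl | rfl <;> simp [bitSign, hu]

variable {ℓ : ℕ}

/-- The character of `(ℤ/2)^ℓ` with frequency `a`. -/
def character (a y : HashValue ℓ) : ℝ := ∏ i, bitSign (a i) (y i)

theorem character_add (a y z : HashValue ℓ) :
    character a (y + z) = character a y * character a z := by
  simp [character, bitSign_add, Finset.prod_mul_distrib]

theorem character_comm (a y : HashValue ℓ) : character a y = character y a := by
  simp [character, bitSign_comm]

theorem character_sq (a y : HashValue ℓ) : character a y ^ 2 = 1 := by
  rw [character, ← Finset.prod_pow]
  refine Finset.prod_eq_one fun i _ => ?_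
  unfold bitSign
  split_ifs <;> norm_num

theorem hashValue_add_self (y : HashValue ℓ) : y + y = 0 := by
  ext i
  exact CharTwo.add_self_eq_zero (y i)

theorem hashValue_neg (y : HashValue ℓ) : -y = y :=
  neg_eq_of_add_eq_zero_left (hashValue_add_self y)

/-- The number of hash values. -/
noncomputable def binCount (ℓ : ℕ) : ℝ := Fintype.card (HashValue ℓ)

theorem binCount_eq (ℓ : ℕ) : binCount ℓ = 2 ^ ℓ := by
  simp [binCount, ZMod.card]

theorem binCount_pos (ℓ : ℕ) : 0 < binCount ℓ := by
  rw [binCount_eq]; positivity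

theorem one_le_binCount (ℓ : ℕ) : 1 ≤ binCount ℓ := by
  rw [binCount_eq]; exact one_le_pow₀ (by norm_num)

theorem tendsto_binCount : Filter.Tendsto binCount Filter.atTop Filter.atTop := by
  rw [show binCount = fun ℓ : ℕ => (2 : ℝ) ^ ℓ from funext binCount_eq]
  exact tendsto_pow_atTop_atTop_of_one_lt (by norm_num)

theorem sum_character (y : HashValue ℓ) :
    ∑ a, character a y = if y = 0 then binCount ℓ else 0 := by
  have h : ∑ a : HashValue ℓ, character a y = ∏ i, ∑ b, bitSign b (y i) := by
    rw [Finset.prod_univ_sum]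
    simp [character, Fintype.piFinset_univ]
  rw [h]
  simp_rw [sum_bitSign]
  split_ifs with hy
  · subst hy; simp [binCount_eq]
  · obtain ⟨i, hi⟩ := Function.ne_iff.1 hy
    exact Finset.prod_eq_zero (Finset.mem_univ i) (by simpa using hi)

theorem sum_character_eq_zero {a : HashValue ℓ} (ha : a ≠ 0) : ∑ y, character a y = 0 := by
  simp_rw [character_comm a]
  rw [sum_character, if_neg ha]

/-- The Fourier transform on `(ℤ/2)^ℓ`. -/
def walsh (f : HashValue ℓ → ℝ) (a : HashValue ℓ) : ℝ := ∑ y, character a y * f y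

/-- Parseval for the unnormalised transform: only the diagonal survives orthogonality of characters.
-/
theorem sum_walsh_sq (f : HashValue ℓ → ℝ) : ∑ a, walsh f a ^ 2 = binCount ℓ * ∑ y, f y ^ 2 := by
  have h (a : HashValue ℓ) : walsh f a ^ 2 = ∑ y, ∑ z, f y * f z * character a (y + z) := by
    rw [walsh, sq, Finset.sum_mul_sum]
    refine Finset.sum_congr rfl fun y _ => Finset.sum_congr rfl fun z _ => ?_
    rw [character_add]; ring
  simp_rw [h]
  rw [Finset.sum_comm, Finset.mul_sum]
  refine Finset.sum_congr rfl fun y _ => ?_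
  rw [Finset.sum_comm]
  simp_rw [← Finset.mul_sum, sum_character]
  have h2 (z : HashValue ℓ) : y + z = 0 ↔ z = y := by
    rw [← neg_eq_iff_add_eq_zero, hashValue_neg, eq_comm]
  simp [h2]
  ring

/-- If a function has small Fourier coefficients, then most of its translates are nearly
orthogonal to a given function. -/
theorem sum_correlation_sq_le {f g : HashValue ℓ → ℝ} {G : ℝ} (hf : ∑ y, f y = 0)
    (hg : ∀ a ≠ 0, walsh g a ^ 2 ≤ G) :
    ∑ u, (∑ y, f y * g (y - u)) ^ 2 ≤ G * ∑ y, f y ^ 2 := by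
  -- Every element is its own inverse, so the correlation is a convolution and its transform is a
  -- product.
  have hw (a : HashValue ℓ) :
      walsh (fun u => ∑ y, f y * g (y - u)) a = walsh f a * walsh g a := by
    unfold walsh
    rw [Finset.sum_mul]
    simp_rw [Finset.mul_sum]
    rw [Finset.sum_comm]
    refine Finset.sum_congr rfl fun y _ => ?_
    refine Fintype.sum_equiv (Equiv.subLeft y) _ _ fun u => ?_
    have h : character a u = character a y * character a (y - u) := by
      rw [← character_add]
      congr 1
      rw [sub_eq_add_neg, hashValue_neg, ← add_assoc, hashValue_add_self, zero_add]
    simp only [Equiv.subLeft_apply]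
    rw [h]
    ring
  -- The zero frequency, where `g` is not controlled, is removed by the zero mean of `f`.
  have h0 : walsh f 0 = 0 := by
    simpa [walsh, character, bitSign] using hf
  have h1 : ∑ a, walsh (fun u => ∑ y, f y * g (y - u)) a ^ 2 ≤ ∑ a, G * walsh f a ^ 2 := by
    refine Finset.sum_le_sum fun a _ => ?_
    rw [hw, mul_pow]
    by_cases ha : a = 0
    · simp [ha, h0]
    · rw [mul_comm]
      gcongr
      exact hg a ha
  rw [← Finset.mul_sum, sum_walsh_sq, sum_walsh_sq] at h1
  refine le_of_mul_le_mul_left (h1.trans_eq ?_) (binCount_pos ℓ)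
  ring

end Characters

/-! ### Weighted keys and their decomposition by last position -/

/-- A family of keys, each of which is a set of positions and has a shift and a weight. -/
structure WeightedKeys (I : Type*) (ℓ : ℕ) where
  keys : Finset (Finset I)
  shift : Finset I → HashValue ℓ
  wt : Finset I → ℝ

namespace WeightedKeys

variable {I : Type*} {ℓ : ℕ}

/-- The hash value of a key under the tables `T`. -/
def hash (F : WeightedKeys I ℓ) (T : I → HashValue ℓ) (x : Finset I) : HashValue ℓ :=
  F.shift x + ∑ β ∈ x, T β

/-- The deviation of the weight of the bin `y` from its mean. -/
noncomputable def bias (F : WeightedKeys I ℓ) (T : I → HashValue ℓ) (y : HashValue ℓ) : ℝ :=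
  ∑ x ∈ F.keys, F.wt x * ((if F.hash T x = y then 1 else 0) - (binCount ℓ)⁻¹)

/-- The sum of the squared deviations of all bins. -/
noncomputable def energy (F : WeightedKeys I ℓ) (T : I → HashValue ℓ) : ℝ := ∑ y, F.bias T y ^ 2

/-- The sum of the squared weights. -/
def mass (F : WeightedKeys I ℓ) : ℝ := ∑ x ∈ F.keys, F.wt x ^ 2

/-- The Fourier coefficients of the weights of the bins. -/
noncomputable def coeff (F : WeightedKeys I ℓ) (T : I → HashValue ℓ) (a : HashValue ℓ) : ℝ :=
  ∑ x ∈ F.keys, F.wt x * character a (F.hash T x)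

theorem mass_nonneg (F : WeightedKeys I ℓ) : 0 ≤ F.mass := Finset.sum_nonneg fun _ _ => sq_nonneg _

theorem energy_nonneg (F : WeightedKeys I ℓ) (T : I → HashValue ℓ) : 0 ≤ F.energy T :=
  Finset.sum_nonneg fun _ _ => sq_nonneg _

theorem wt_eq_zero {F : WeightedKeys I ℓ} (h : F.mass = 0) {x : Finset I} (hx : x ∈ F.keys) :
    F.wt x = 0 := by
  have := (Finset.sum_eq_zero_iff_of_nonneg fun _ _ => sq_nonneg _).1 h x hx
  simpa using this

theorem bias_eq_zero {F : WeightedKeys I ℓ} (h : F.mass = 0) (T : I → HashValue ℓ)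
    (y : HashValue ℓ) : F.bias T y = 0 :=
  Finset.sum_eq_zero fun x hx => by rw [wt_eq_zero h hx, zero_mul]

theorem coeff_eq_zero {F : WeightedKeys I ℓ} (h : F.mass = 0) (T : I → HashValue ℓ)
    (a : HashValue ℓ) : F.coeff T a = 0 :=
  Finset.sum_eq_zero fun x hx => by rw [wt_eq_zero h hx, zero_mul]

theorem sum_bias (F : WeightedKeys I ℓ) (T : I → HashValue ℓ) : ∑ y, F.bias T y = 0 := by
  unfold bias
  rw [Finset.sum_comm]
  refine Finset.sum_eq_zero fun x _ => ?_
  rw [← Finset.mul_sum, Finset.sum_sub_distrib]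
  have : (Fintype.card (HashValue ℓ) : ℝ) * (binCount ℓ)⁻¹ = 1 :=
    mul_inv_cancel₀ (binCount_pos ℓ).ne'
  simp only [Finset.sum_ite_eq, Finset.mem_univ, if_true, Finset.sum_const, Finset.card_univ,
    nsmul_eq_mul, this, sub_self, mul_zero]

/-- Centering a bin weight subtracts a constant, which only affects the zero frequency. -/
theorem walsh_bias (F : WeightedKeys I ℓ) (T : I → HashValue ℓ) {a : HashValue ℓ} (ha : a ≠ 0) :
    walsh (F.bias T) a = F.coeff T a := by
  unfold walsh bias coeff
  simp_rw [Finset.mul_sum]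
  rw [Finset.sum_comm]
  refine Finset.sum_congr rfl fun x _ => ?_
  have h (y : HashValue ℓ) : character a y * (F.wt x *
      ((if F.hash T x = y then 1 else 0) - (binCount ℓ)⁻¹)) =
      F.wt x * (character a y * if F.hash T x = y then 1 else 0) -
        F.wt x * (binCount ℓ)⁻¹ * character a y := by ring
  simp_rw [h, Finset.sum_sub_distrib, ← Finset.mul_sum, sum_character_eq_zero ha]
  simp

section Update

variable [DecidableEq I] {F : WeightedKeys I ℓ} {β : I}

theorem hash_update {x : Finset I} (h : β ∉ x) (T : I → HashValue ℓ) (u : HashValue ℓ) :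
    F.hash (update T β u) x = F.hash T x := by
  unfold hash
  congr 1
  refine Finset.sum_congr rfl fun γ hγ => ?_
  rw [update_of_ne]
  rintro rfl
  exact h hγ

theorem bias_update (h : ∀ x ∈ F.keys, β ∉ x) (T : I → HashValue ℓ) (u : HashValue ℓ) :
    F.bias (update T β u) = F.bias T := by
  ext y
  unfold bias
  exact Finset.sum_congr rfl fun x hx => by rw [hash_update (h x hx)]

theorem energy_update (h : ∀ x ∈ F.keys, β ∉ x) (T : I → HashValue ℓ) (u : HashValue ℓ) :
    F.energy (update T β u) = F.energy T := by
  unfold energy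
  rw [bias_update h]

theorem coeff_update (h : ∀ x ∈ F.keys, β ∉ x) (T : I → HashValue ℓ) (u : HashValue ℓ) :
    F.coeff (update T β u) = F.coeff T := by
  ext a
  unfold coeff
  exact Finset.sum_congr rfl fun x hx => by rw [hash_update (h x hx)]

end Update

/-- The keys all of whose positions have rank less than `k`. -/
def below (F : WeightedKeys I ℓ) (r : I → ℕ) (k : ℕ) : WeightedKeys I ℓ where
  keys := F.keys.filter fun x => ∀ β ∈ x, r β < k
  shift := F.shift
  wt := F.wt

theorem below_keys (F : WeightedKeys I ℓ) (r : I → ℕ) (k : ℕ) :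
    (F.below r k).keys = F.keys.filter fun x => ∀ β ∈ x, r β < k := rfl

theorem notMem_of_mem_below {F : WeightedKeys I ℓ} {r : I → ℕ} {k : ℕ} {β : I} (h : k ≤ r β) :
    ∀ x ∈ (F.below r k).keys, β ∉ x := by
  intro x hx hβ
  have := (Finset.mem_filter.1 hx).2 β hβ
  omega

theorem mass_below_le (F : WeightedKeys I ℓ) (r : I → ℕ) (k : ℕ) : (F.below r k).mass ≤ F.mass :=
  Finset.sum_le_sum_of_subset_of_nonneg (Finset.filter_subset _ _) fun _ _ _ => sq_nonneg _

theorem exists_below_eq [Fintype I] (F : WeightedKeys I ℓ) (r : I → ℕ) :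
    ∃ k, (∀ β, r β < k) ∧ F.below r k = F := by
  refine ⟨(Finset.univ.sup r) + 1, ?_, ?_⟩
  · exact fun β => Nat.lt_succ_of_le (Finset.le_sup (Finset.mem_univ β))
  · cases F
    simp only [below, mk.injEq, and_self, and_true]
    exact Finset.filter_true_of_mem fun x _ β _ =>
      Nat.lt_succ_of_le (Finset.le_sup (Finset.mem_univ β))

variable [DecidableEq I]

/-- The keys whose position of the largest rank is `α`, with this position erased. -/
def link (F : WeightedKeys I ℓ) (r : I → ℕ) (α : I) : WeightedKeys I ℓ where
  keys := (F.keys.filter fun x => α ∈ x ∧ ∀ β ∈ x, β ≠ α → r β < r α).image fun x => x.erase α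
  shift := fun x => F.shift (insert α x)
  wt := fun x => F.wt (insert α x)

theorem mem_link {F : WeightedKeys I ℓ} {r : I → ℕ} {α : I} {x : Finset I} :
    x ∈ (F.link r α).keys ↔ insert α x ∈ F.keys ∧ ∀ β ∈ x, r β < r α := by
  simp only [link, Finset.mem_image, Finset.mem_filter]
  constructor
  · rintro ⟨y, ⟨hy, hα, h⟩, rfl⟩
    rw [Finset.insert_erase hα]
    exact ⟨hy, fun β hβ => h β (Finset.mem_of_mem_erase hβ) (Finset.ne_of_mem_erase hβ)⟩
  · rintro ⟨hx, h⟩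
    refine ⟨insert α x, ⟨hx, Finset.mem_insert_self _ _, fun β hβ hne => ?_⟩, ?_⟩
    · exact h β (Finset.mem_of_mem_insert_of_ne hβ hne)
    · exact Finset.erase_insert fun hα => (h α hα).false

theorem notMem_of_mem_link {F : WeightedKeys I ℓ} {r : I → ℕ} {α β : I} (h : r α ≤ r β) :
    ∀ x ∈ (F.link r α).keys, β ∉ x := by
  intro x hx hβ
  have := (mem_link.1 hx).2 β hβ
  omega

theorem card_le_of_mem_link {F : WeightedKeys I ℓ} {r : I → ℕ} {α : I} {c : ℕ}
    (h : ∀ x ∈ F.keys, x.card ≤ c + 1) : ∀ x ∈ (F.link r α).keys, x.card ≤ c := by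
  intro x hx
  have h1 := h _ (mem_link.1 hx).1
  rw [Finset.card_insert_of_notMem (notMem_of_mem_link le_rfl x hx)] at h1
  omega

theorem sum_link (F : WeightedKeys I ℓ) (r : I → ℕ) (α : I) (φ : Finset I → ℝ) :
    ∑ x ∈ (F.link r α).keys, φ (insert α x) =
      ∑ x ∈ F.keys.filter (fun x => α ∈ x ∧ ∀ β ∈ x, β ≠ α → r β < r α), φ x := by
  simp only [link]
  rw [Finset.sum_image]
  · refine Finset.sum_congr rfl fun x hx => ?_
    rw [Finset.insert_erase (Finset.mem_filter.1 hx).2.1]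
  · intro x hx y hy h
    have hx := (Finset.mem_filter.1 hx).2.1
    have hy := (Finset.mem_filter.1 hy).2.1
    simp only at h
    rw [← Finset.insert_erase hx, h, Finset.insert_erase hy]

theorem hash_insert {F : WeightedKeys I ℓ} {r : I → ℕ} {α : I} {x : Finset I}
    (hx : x ∈ (F.link r α).keys) (T : I → HashValue ℓ) :
    F.hash T (insert α x) = T α + (F.link r α).hash T x := by
  simp only [hash, link]
  rw [Finset.sum_insert (notMem_of_mem_link le_rfl x hx)]
  abel

section Split

variable {r : I → ℕ} (hr : Injective r) (F : WeightedKeys I ℓ)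
include hr

/-- A key newly admitted at this rank must contain `α`, since injectivity of `r` leaves no other
position of rank `r α`; it then has `α` as its last position. -/
theorem sum_below_succ (α : I) (φ : Finset I → ℝ) :
    ∑ x ∈ (F.below r (r α + 1)).keys, φ x =
      ∑ x ∈ (F.below r (r α)).keys, φ x + ∑ x ∈ (F.link r α).keys, φ (insert α x) := by
  rw [sum_link, below_keys, below_keys, ← Finset.sum_union]
  · refine Finset.sum_congr ?_ fun _ _ => rfl
    ext x
    simp only [Finset.mem_filter, Finset.mem_union]
    constructor
    · rintro ⟨hx, h⟩
      by_cases hα : α ∈ x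
      · refine Or.inr ⟨hx, hα, fun β hβ hne => ?_⟩
        exact lt_of_le_of_ne (Nat.lt_succ_iff.1 (h β hβ)) (hr.ne hne)
      · refine Or.inl ⟨hx, fun β hβ => ?_⟩
        refine lt_of_le_of_ne (Nat.lt_succ_iff.1 (h β hβ)) (hr.ne ?_)
        rintro rfl
        exact hα hβ
    · rintro (⟨hx, h⟩ | ⟨hx, hα, h⟩)
      · exact ⟨hx, fun β hβ => (h β hβ).trans (Nat.lt_succ_self _)⟩
      · refine ⟨hx, fun β hβ => ?_⟩
        by_cases hne : β = α
        · subst hne; exact Nat.lt_succ_self _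
        · exact (h β hβ hne).trans (Nat.lt_succ_self _)
  · rw [Finset.disjoint_left]
    intro x hx hx'
    exact ((Finset.mem_filter.1 hx).2 α (Finset.mem_filter.1 hx').2.1).false

theorem filter_rank_succ [Fintype I] (α : I) :
    Finset.univ.filter (fun β => r β < r α + 1) =
      insert α (Finset.univ.filter fun β => r β < r α) := by
  ext β
  simp only [Finset.mem_filter, Finset.mem_univ, true_and, Finset.mem_insert]
  rw [Nat.lt_succ_iff, le_iff_lt_or_eq, hr.eq_iff, or_comm]

omit hr [DecidableEq I] in
theorem below_succ_of_forall_ne {k : ℕ} (hk : ∀ α, r α ≠ k) : F.below r (k + 1) = F.below r k := by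
  have h (β : I) : r β < k + 1 ↔ r β < k := by
    have := hk β
    omega
  simp [below, h]

omit hr [DecidableEq I] in
theorem filter_rank_succ_of_forall_ne [Fintype I] {k : ℕ} (hk : ∀ α, r α ≠ k) :
    Finset.univ.filter (fun β => r β < k + 1) = Finset.univ.filter fun β => r β < k := by
  ext β
  have := hk β
  simp only [Finset.mem_filter, Finset.mem_univ, true_and]
  omega

omit hr in
-- The empty key has no last position and lies in no link; it is the deterministic starting value of
-- the martingales.
theorem keys_below_zero : (F.below r 0).keys = F.keys.filter (fun x => x = ∅) := by
  ext x
  simp [below, Finset.eq_empty_iff_forall_notMem]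

theorem sum_below [Fintype I] (k : ℕ) (φ : Finset I → ℝ) :
    ∑ x ∈ (F.below r k).keys, φ x = ∑ x ∈ (F.below r 0).keys, φ x +
      ∑ α with r α < k, ∑ x ∈ (F.link r α).keys, φ (insert α x) := by
  induction k with
  | zero => simp
  | succ k ih =>
    by_cases hk : ∃ α, r α = k
    · obtain ⟨α, rfl⟩ := hk
      rw [sum_below_succ hr, ih, filter_rank_succ hr, Finset.sum_insert (by simp)]
      ring
    · push Not at hk
      rw [below_succ_of_forall_ne F hk, ih, filter_rank_succ_of_forall_ne hk]

theorem sum_keys [Fintype I] (φ : Finset I → ℝ) :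
    ∑ x ∈ F.keys, φ x = ∑ x ∈ (F.below r 0).keys, φ x +
      ∑ α, ∑ x ∈ (F.link r α).keys, φ (insert α x) := by
  obtain ⟨k, hk, hF⟩ := F.exists_below_eq r
  have h := F.sum_below hr k φ
  rwa [hF, Finset.filter_true_of_mem fun α _ => hk α] at h

/-- Each nonempty key has exactly one last position, so the links partition the nonempty keys. -/
theorem sum_mass_link_le [Fintype I] : ∑ α, (F.link r α).mass ≤ F.mass := by
  have h := F.sum_keys hr fun x => F.wt x ^ 2
  have h0 : 0 ≤ ∑ x ∈ (F.below r 0).keys, F.wt x ^ 2 := Finset.sum_nonneg fun _ _ => sq_nonneg _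
  simp only [mass, link] at h ⊢
  linarith

theorem mass_link_le [Fintype I] (α : I) : (F.link r α).mass ≤ F.mass :=
  (Finset.single_le_sum (f := fun α => (F.link r α).mass) (fun _ _ => mass_nonneg _)
    (Finset.mem_univ α)).trans (F.sum_mass_link_le hr)

theorem sum_card_link_le [Fintype I] :
    ∑ α, ((F.link r α).keys.card : ℝ) ≤ F.keys.card := by
  have h := F.sum_keys hr fun _ => 1
  simp only [Finset.sum_const, nsmul_eq_mul, mul_one] at h
  rw [h]
  have : (0 : ℝ) ≤ (F.below r 0).keys.card := by positivity
  linarith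

omit hr in
theorem sum_link_bias (α : I) (T : I → HashValue ℓ) (y : HashValue ℓ) :
    ∑ x ∈ (F.link r α).keys, F.wt (insert α x) *
      ((if F.hash T (insert α x) = y then 1 else 0) - (binCount ℓ)⁻¹) =
      (F.link r α).bias T (y - T α) := by
  refine Finset.sum_congr rfl fun x hx => ?_
  rw [hash_insert hx]
  simp only [eq_sub_iff_add_eq, add_comm (T α)]
  rfl

theorem bias_eq [Fintype I] (T : I → HashValue ℓ) (y : HashValue ℓ) :
    F.bias T y = (F.below r 0).bias T y + ∑ α, (F.link r α).bias T (y - T α) := by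
  rw [bias, F.sum_keys hr]
  congr 1
  exact Finset.sum_congr rfl fun _ _ => F.sum_link_bias _ T y

theorem bias_below_succ (α : I) (T : I → HashValue ℓ) (y : HashValue ℓ) :
    (F.below r (r α + 1)).bias T y = (F.below r (r α)).bias T y +
      (F.link r α).bias T (y - T α) := by
  rw [← F.sum_link_bias α T y]
  exact sum_below_succ hr F α fun x => F.wt x *
      ((if F.hash T x = y then 1 else 0) - (binCount ℓ)⁻¹)

theorem coeff_eq [Fintype I] (T : I → HashValue ℓ) (a : HashValue ℓ) :
    F.coeff T a = (F.below r 0).coeff T a +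
      ∑ α, character a (T α) * (F.link r α).coeff T a := by
  rw [coeff, F.sum_keys hr]
  congr 1
  refine Finset.sum_congr rfl fun _ _ => ?_
  rw [coeff, Finset.mul_sum]
  refine Finset.sum_congr rfl fun x hx => ?_
  rw [hash_insert hx, character_add]
  simp only [link]
  ring

/-- Expand the square; the translation by `T α` does not change the energy of the link. -/
theorem energy_below_succ (α : I) (T : I → HashValue ℓ) :
    (F.below r (r α + 1)).energy T = (F.below r (r α)).energy T + (F.link r α).energy T +
      2 * ∑ y, (F.below r (r α)).bias T y * (F.link r α).bias T (y - T α) := by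
  unfold energy
  have h : ∑ y, (F.link r α).bias T y ^ 2 = ∑ y, (F.link r α).bias T (y - T α) ^ 2 :=
    (Fintype.sum_equiv (Equiv.subRight (T α)) _ _ fun y => rfl).symm
  rw [h, Finset.mul_sum, ← Finset.sum_add_distrib, ← Finset.sum_add_distrib]
  refine Finset.sum_congr rfl fun y _ => ?_
  rw [bias_below_succ hr]
  ring

theorem energy_below [Fintype I] (k : ℕ) (T : I → HashValue ℓ) :
    (F.below r k).energy T = (F.below r 0).energy T + ∑ α with r α < k, ((F.link r α).energy T +
      2 * ∑ y, (F.below r (r α)).bias T y * (F.link r α).bias T (y - T α)) := by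
  induction k with
  | zero => simp
  | succ k ih =>
    by_cases hk : ∃ α, r α = k
    · obtain ⟨α, rfl⟩ := hk
      rw [energy_below_succ hr, ih, filter_rank_succ hr, Finset.sum_insert (by simp)]
      ring
    · push Not at hk
      rw [below_succ_of_forall_ne F hk, ih, filter_rank_succ_of_forall_ne hk]

end Split

section Empty

variable {F : WeightedKeys I ℓ} (h : ∀ x ∈ F.keys, x = ∅)
include h

omit [DecidableEq I] in
-- The base case of the inductions: at most one key, whose hash value is its shift.
theorem keys_eq_of_forall_eq_empty : F.keys = ∅ ∨ F.keys = {∅} := by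
  rcases F.keys.eq_empty_or_nonempty with h0 | h0
  · exact Or.inl h0
  · exact Or.inr (Finset.eq_singleton_iff_nonempty_unique_mem.2 ⟨h0, h⟩)

omit [DecidableEq I] in
theorem coeff_sq_le_mass (T : I → HashValue ℓ) (a : HashValue ℓ) : F.coeff T a ^ 2 ≤ F.mass := by
  unfold coeff mass
  rcases keys_eq_of_forall_eq_empty h with h0 | h0
  · simp [h0]
  · simp [h0, mul_pow, character_sq]

omit [DecidableEq I] in
theorem energy_le_mass (T : I → HashValue ℓ) : F.energy T ≤ F.mass := by
  unfold energy bias mass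
  rcases keys_eq_of_forall_eq_empty h with h0 | h0
  · simp [h0]
  · simp only [h0, Finset.sum_singleton, mul_pow, ← Finset.mul_sum]
    refine mul_le_of_le_one_right (sq_nonneg _) ?_
    have hm := binCount_pos ℓ
    have h1 (y : HashValue ℓ) : ((if F.hash T ∅ = y then (1 : ℝ) else 0) - (binCount ℓ)⁻¹) ^ 2 =
        (if F.hash T ∅ = y then (1 - 2 * (binCount ℓ)⁻¹) else 0) + (binCount ℓ)⁻¹ ^ 2 := by
      split_ifs <;> ring
    simp_rw [h1, Finset.sum_add_distrib]
    simp only [Finset.sum_ite_eq, Finset.mem_univ, if_true, Finset.sum_const, Finset.card_univ,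
      nsmul_eq_mul]
    rw [show (Fintype.card (HashValue ℓ) : ℝ) = binCount ℓ from rfl]
    have h2 : binCount ℓ * (binCount ℓ)⁻¹ ^ 2 = (binCount ℓ)⁻¹ := by field_simp
    have h3 : 0 < (binCount ℓ)⁻¹ := by positivity
    linarith

omit [DecidableEq I] in
theorem abs_bias_le_one (hw : ∀ x ∈ F.keys, |F.wt x| ≤ 1) (T : I → HashValue ℓ) (y : HashValue ℓ) :
    |F.bias T y| ≤ 1 := by
  unfold bias
  rcases keys_eq_of_forall_eq_empty h with h0 | h0
  · simp [h0]
  · simp only [h0, Finset.sum_singleton, Finset.mem_singleton, forall_eq] at hw ⊢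
    rw [abs_mul]
    refine mul_le_one₀ hw (abs_nonneg _) ?_
    have h1 : (binCount ℓ)⁻¹ ≤ 1 := inv_le_one_of_one_le₀ (one_le_binCount ℓ)
    have h2 : 0 ≤ (binCount ℓ)⁻¹ := inv_nonneg.2 (binCount_pos ℓ).le
    rw [abs_le]
    split_ifs <;> constructor <;> linarith

end Empty

end WeightedKeys

/-! ### Stopped martingales -/

/-- Freedman's inequality for a stopped martingale. -/
theorem fraction_stopped_sum_le {I H : Type*} [Fintype I] [DecidableEq I] [AddCommGroup H]
    [Fintype H] {r : I → ℕ} (hr : Injective r) (D : I → (I → H) → ℝ)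
    (good : I → (I → H) → Prop) [∀ α T, Decidable (good α T)] (v : I → ℝ)
    {M V t : ℝ} (hM : 0 < M) (hV : 0 < V) (ht : 0 < t) (hv : ∀ α, 0 ≤ v α)
    (adapted : ∀ α β T u, r β < r α → D β (update T α u) = D β T)
    (predictable : ∀ α β T u, r β ≤ r α → (good β (update T α u) ↔ good β T))
    (bounded : ∀ α T, good α T → |D α T| ≤ M)
    (mean : ∀ α T, good α T → ∑ u, D α (update T α u) = 0)
    (sq : ∀ α T, good α T → ∑ u, D α (update T α u) ^ 2 ≤ Fintype.card H * v α)
    (hvV : ∑ α, v α ≤ V) :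
    fraction (fun T => t ≤ |∑ α, if good α T then D α T else 0|) ≤
      2 * Real.exp (-(t / (4 * M) * Real.log (1 + t * M / V))) := by
  -- Whether `α` is good is decided before its entry is revealed, so the truncated terms still have
  -- conditional mean zero.
  refine fraction_abs_sum_le r hr (fun α T => if good α T then D α T else 0) v hM hV ht
    ?_ ?_ ?_ ?_ hvV
  · intro α β T u h
    simp only [predictable α β T u h.le, adapted α β T u h]
  · intro α T
    split_ifs with h
    · exact bounded α T h
    · simpa using hM.le
  · intro α T
    simp only [predictable α α T _ le_rfl]
    by_cases h : good α T
    · simpa only [h, if_true] using mean α T h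
    · simp [h]
  · intro α T
    simp only [predictable α α T _ le_rfl]
    by_cases h : good α T
    · simpa only [h, if_true] using sq α T h
    · simpa [h] using mul_nonneg (Nat.cast_nonneg _) (hv α)

theorem fraction_martingale_le {I H : Type*} [Fintype I] [DecidableEq I] [AddCommGroup H]
    [Fintype H] {r : I → ℕ} (hr : Injective r) (D : I → (I → H) → ℝ)
    (good : I → (I → H) → Prop) (v : I → ℝ)
    {M V t : ℝ} (hM : 0 < M) (hV : 0 < V) (ht : 0 < t) (hv : ∀ α, 0 ≤ v α)
    (adapted : ∀ α β T u, r β < r α → D β (update T α u) = D β T)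
    (predictable : ∀ α β T u, r β ≤ r α → (good β (update T α u) ↔ good β T))
    (bounded : ∀ α T, good α T → |D α T| ≤ M)
    (mean : ∀ α T, good α T → ∑ u, D α (update T α u) = 0)
    (sq : ∀ α T, good α T → ∑ u, D α (update T α u) ^ 2 ≤ Fintype.card H * v α)
    (hvV : ∑ α, v α ≤ V) :
    fraction (fun T => (∀ α, good α T) ∧ t ≤ |∑ α, D α T|) ≤
      2 * Real.exp (-(t / (4 * M) * Real.log (1 + t * M / V))) := by
  classical
  refine (fraction_mono fun T hT => ?_).trans (fraction_stopped_sum_le hr D good v hM hV ht hv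
    adapted predictable bounded mean sq hvV)
  simp only [hT.1, if_true]
  exact hT.2

/-! ### Estimates for a large number of bins -/

section Asymptotics

theorem eventually_mul_exp_neg_le {a δ : ℝ} (ha : 0 < a) (hδ : 0 < δ) (C γ : ℝ) :
    ∀ᶠ m : ℝ in atTop, C * Real.exp (-(a * m ^ δ)) ≤ 1 / m ^ γ := by
  have h1 := (tendsto_rpow_mul_exp_neg_mul_atTop_nhds_zero (γ / δ) a ha).comp (tendsto_rpow_atTop hδ)
  have h2 := h1.const_mul C
  rw [mul_zero] at h2
  filter_upwards [h2.eventually (eventually_le_nhds (show (0 : ℝ) < 1 by norm_num)),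
    eventually_gt_atTop 0] with m hm hm0
  simp only [comp_apply] at hm
  rw [← Real.rpow_mul hm0.le, mul_div_cancel₀ _ hδ.ne'] at hm
  rw [le_div_iff₀ (by positivity)]
  calc _ = C * (m ^ γ * Real.exp (-a * m ^ δ)) := by rw [neg_mul]; ring
    _ ≤ 1 := hm

theorem eventually_le_rpow (C : ℝ) {δ : ℝ} (hδ : 0 < δ) : ∀ᶠ m : ℝ in atTop, C ≤ m ^ δ :=
  (tendsto_rpow_atTop hδ).eventually_ge_atTop C

/-- Union bounds multiply the error by a constant. The inductions therefore run with exponent `γ +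
1`, and the spare factor `m` absorbs it. -/
theorem four_mul_div_rpow_le {m k : ℝ} (hm : 4 ≤ m) (hk : 0 ≤ k) (γ : ℝ) :
    4 * k / m ^ (γ + 1) ≤ k / m ^ γ := by
  have hm0 : 0 < m := by linarith
  rw [Real.rpow_add hm0, Real.rpow_one, div_le_div_iff₀ (by positivity) (by positivity)]
  have : 0 ≤ k * m ^ γ := by positivity
  nlinarith

theorem exp_neg_mul_log_le {m a γ : ℝ} (hm : 1 ≤ m) (h : γ ≤ a) :
    Real.exp (-(a * Real.log m)) ≤ 1 / m ^ γ := by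
  rw [Real.rpow_def_of_pos (by linarith), one_div, ← Real.exp_neg]
  refine Real.exp_le_exp.2 ?_
  have := Real.log_nonneg hm
  nlinarith

end Asymptotics

/-! ### Small Fourier coefficients -/

namespace WeightedKeys

variable {I : Type*} {ℓ : ℕ}

theorem one_le_card {F : WeightedKeys I ℓ} (h : 0 < F.mass) : (1 : ℝ) ≤ F.keys.card := by
  have : F.keys.Nonempty := by
    rw [Finset.nonempty_iff_ne_empty]
    intro h0
    simp [mass, h0] at h
  exact_mod_cast this.card_pos

theorem fraction_exists_link_le [DecidableEq I] [Fintype I] {r : I → ℕ} (hr : Injective r)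
    (F : WeightedKeys I ℓ) (p : I → (I → HashValue ℓ) → Prop) {C : ℝ} (hC : 0 < C)
    (h : ∀ α, fraction (p α) ≤ (F.link r α).keys.card / C) :
    fraction (fun T => ∃ α ∈ Finset.univ, p α T) ≤ F.keys.card / C := by
  refine (fraction_exists_le _ _).trans ((Finset.sum_le_sum fun α _ => h α).trans ?_)
  rw [← Finset.sum_div]
  gcongr
  exact F.sum_card_link_le hr

theorem forall_mem_below_zero [DecidableEq I] {F : WeightedKeys I ℓ} {r : I → ℕ} :
    ∀ x ∈ (F.below r 0).keys, x = ∅ := by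
  intro x hx
  rw [keys_below_zero] at hx
  exact (Finset.mem_filter.1 hx).2

theorem forall_eq_empty {F : WeightedKeys I ℓ} (h : ∀ x ∈ F.keys, x.card ≤ 0) :
    ∀ x ∈ F.keys, x = ∅ := fun x hx => Finset.card_eq_zero.1 (Nat.le_zero.1 (h x hx))

/-- With high probability, all nontrivial Fourier coefficients are small. -/
theorem fraction_coeff_le (c : ℕ) : ∀ γ ε : ℝ, 0 < ε → ∀ᶠ ℓ : ℕ in atTop,
    ∀ (I : Type*) [Fintype I] [DecidableEq I] (r : I → ℕ), Injective r →
    ∀ F : WeightedKeys I ℓ, (∀ x ∈ F.keys, x.card ≤ c) →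
      fraction (fun T => ∃ a ≠ 0, binCount ℓ ^ ε * F.mass < F.coeff T a ^ 2) ≤
        F.keys.card / binCount ℓ ^ γ := by
  induction c with
  | zero =>
    intro γ ε hε
    refine Eventually.of_forall fun ℓ I _ _ r hr F hF => ?_
    rw [fraction_eq_zero]
    · have := binCount_pos ℓ; positivity
    · rintro T ⟨a, -, ha⟩
      have h1 := coeff_sq_le_mass (forall_eq_empty hF) T a
      have h2 : 1 ≤ binCount ℓ ^ ε := Real.one_le_rpow (one_le_binCount ℓ) hε.le
      nlinarith [F.mass_nonneg]
  | succ c ih =>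
    intro γ ε hε
    have hε4 : 0 < ε / 4 := by positivity
    filter_upwards [ih (γ + 1) (ε / 2) (by positivity), tendsto_binCount.eventually
      (eventually_mul_exp_neg_le (show (0 : ℝ) < 1 / 8 by norm_num) hε4 2 (γ + 2)),
      tendsto_binCount.eventually (eventually_le_rpow 4 hε4),
      tendsto_binCount.eventually_ge_atTop 4] with ℓ ih hexp hX hm I _ _ r hr F hF
    have hm0 := binCount_pos ℓ
    set m := binCount ℓ with hmdef
    -- By induction a link has coefficients at most X √mass. The martingale costs another factor X,
    -- giving X² √W in total, whose square is m^ε W.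
    set X := m ^ (ε / 4) with hXdef
    have hX2 : m ^ (ε / 2) = X ^ 2 := by
      rw [hXdef, ← Real.rpow_natCast, ← Real.rpow_mul hm0.le]; congr 1; push_cast; ring
    have hX4 : m ^ ε = X ^ 4 := by
      rw [hXdef, ← Real.rpow_natCast, ← Real.rpow_mul hm0.le]; congr 1; push_cast; ring
    rcases F.mass_nonneg.eq_or_lt with hW | hW
    · rw [fraction_eq_zero]
      · positivity
      · rintro T ⟨a, -, ha⟩
        simp [coeff_eq_zero hW.symm, ← hW] at ha
    set W := F.mass with hWdef
    have hk := one_le_card hW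
    set M := X * √W with hMdef
    have hM : 0 < M := by positivity
    have hM2 : M ^ 2 = X ^ 2 * W := by rw [hMdef, mul_pow, Real.sq_sqrt hW.le]
    have ht : 0 < X * M / 2 := by positivity
    have key (a : HashValue ℓ) (ha : a ≠ 0) : fraction (fun T =>
        (∀ α, (F.link r α).coeff T a ^ 2 ≤ X ^ 2 * (F.link r α).mass) ∧
        X * M / 2 ≤ |∑ α, character a (T α) * (F.link r α).coeff T a|) ≤
        1 / m ^ (γ + 2) := by
      refine (fraction_martingale_le hr (fun α T => character a (T α) * (F.link r α).coeff T a)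
        (fun α T => (F.link r α).coeff T a ^ 2 ≤ X ^ 2 * (F.link r α).mass)
        (fun α => X ^ 2 * (F.link r α).mass) (M := M) (V := M ^ 2) (t := X * M / 2)
        hM (by positivity) ht ?_ ?_ ?_ ?_ ?_ ?_ ?_).trans ?_
      · exact fun α => mul_nonneg (by positivity) (mass_nonneg _)
      · intro α β T u h
        have hne : β ≠ α := by rintro rfl; exact h.false
        simp only [coeff_update (notMem_of_mem_link h.le), update_of_ne hne]
      · intro α β T u h
        simp only [coeff_update (notMem_of_mem_link h)]
      · intro α T h
        refine abs_le_of_sq_le_sq ?_ hM.le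
        rw [mul_pow, character_sq, one_mul, hM2]
        refine h.trans ?_
        gcongr
        exact F.mass_link_le hr α
      · intro α T _
        simp only [coeff_update (notMem_of_mem_link le_rfl), update_self]
        rw [← Finset.sum_mul, sum_character_eq_zero ha, zero_mul]
      · intro α T h
        simp only [coeff_update (notMem_of_mem_link le_rfl), update_self, mul_pow, character_sq,
          one_mul, Finset.sum_const, Finset.card_univ, nsmul_eq_mul]
        gcongr
      · rw [← Finset.mul_sum, hM2]
        gcongr
        exact F.sum_mass_link_le hr
      · refine le_trans ?_ hexp
        gcongr 2 * Real.exp (-?_)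
        have h1 : X * M / 2 / (4 * M) = 1 / 8 * X := by field_simp; norm_num
        have h2 : X * M / 2 * M / M ^ 2 = X / 2 := by field_simp
        rw [h1, h2]
        -- X ≥ 4 makes 1 + X/2 at least 3 > e, so the logarithm is at least 1.
        refine le_mul_of_one_le_right (by positivity) ?_
        rw [Real.le_log_iff_exp_le (by positivity)]
        have := Real.exp_one_lt_d9
        linarith
    calc fraction (fun T => ∃ a ≠ 0, m ^ ε * W < F.coeff T a ^ 2)
        ≤ fraction (fun T => (∃ α ∈ Finset.univ, ∃ a ≠ 0, m ^ (ε / 2) * (F.link r α).mass <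
            (F.link r α).coeff T a ^ 2) ∨ ∃ a ∈ Finset.univ.filter (· ≠ 0),
            ((∀ α, (F.link r α).coeff T a ^ 2 ≤ X ^ 2 * (F.link r α).mass) ∧
            X * M / 2 ≤ |∑ α, character a (T α) * (F.link r α).coeff T a|)) := by
          refine fraction_mono fun T => ?_
          rintro ⟨a, ha, hbig⟩
          rw [or_iff_not_imp_left]
          intro hgood
          push Not at hgood
          rw [hX2] at hgood
          refine ⟨a, by simpa using ha, fun α => hgood α (Finset.mem_univ _) a ha, ?_⟩
          have h0 := (coeff_sq_le_mass forall_mem_below_zero T a).trans (F.mass_below_le r 0)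
          have h1 : |(F.below r 0).coeff T a| ≤ X * M / 2 := by
            refine abs_le_of_sq_le_sq (h0.trans ?_) ht.le
            rw [div_pow, mul_pow, hM2]
            have : (16 : ℝ) ≤ X ^ 2 := by nlinarith
            nlinarith
          have h2 : X * M < |F.coeff T a| := by
            refine lt_abs.2 ?_
            by_contra hcon
            push Not at hcon
            have : F.coeff T a ^ 2 ≤ (X * M) ^ 2 := by
              rw [sq_le_sq, abs_of_pos (show 0 < X * M by positivity), abs_le]
              constructor <;> linarith
            rw [mul_pow, hM2] at this
            rw [hX4] at hbig
            nlinarith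
          rw [F.coeff_eq hr] at h2
          have h3 := abs_add_le ((F.below r 0).coeff T a)
            (∑ α, character a (T α) * (F.link r α).coeff T a)
          linarith
      _ ≤ F.keys.card / m ^ (γ + 1) + ∑ a : HashValue ℓ with a ≠ 0, 1 / m ^ (γ + 2) := by
          refine (fraction_or_le _ _).trans (add_le_add ?_ ?_)
          · exact F.fraction_exists_link_le hr _ (by positivity)
              fun α => ih I r hr _ (card_le_of_mem_link hF)
          · refine (fraction_exists_le _ _).trans (Finset.sum_le_sum fun a ha => ?_)
            exact key a (Finset.mem_filter.1 ha).2
      _ ≤ F.keys.card / m ^ (γ + 1) + m * (1 / m ^ (γ + 2)) := by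
          rw [Finset.sum_const, nsmul_eq_mul]
          gcongr
          exact Nat.cast_le.2 (Finset.card_le_univ _)
      _ ≤ 4 * F.keys.card / m ^ (γ + 1) := by
          have : m * (1 / m ^ (γ + 2)) = 1 / m ^ (γ + 1) := by
            rw [show γ + 2 = (γ + 1) + 1 by ring, Real.rpow_add hm0 (γ + 1), Real.rpow_one]
            field_simp
          rw [this, ← add_div]
          gcongr
          linarith
      _ ≤ _ := four_mul_div_rpow_le hm (by positivity) γ

end WeightedKeys

/-! ### Energy bounds -/

namespace WeightedKeys

variable {I : Type*} {ℓ : ℕ}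

theorem mem_keys_of_mem_below {F : WeightedKeys I ℓ} {r : I → ℕ} {k : ℕ} {x : Finset I}
    (hx : x ∈ (F.below r k).keys) : x ∈ F.keys := (Finset.mem_filter.1 hx).1

/-- Twice the correlation of the earlier keys with the keys whose last position is `α`. -/
noncomputable def cross [DecidableEq I] (F : WeightedKeys I ℓ) (r : I → ℕ) (α : I)
    (T : I → HashValue ℓ) : ℝ :=
  2 * ∑ y, (F.below r (r α)).bias T y * (F.link r α).bias T (y - T α)

section Cross

variable [DecidableEq I] (F : WeightedKeys I ℓ) (r : I → ℕ) (α : I) (T : I → HashValue ℓ)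

theorem cross_update_self (u : HashValue ℓ) : F.cross r α (update T α u) =
    2 * ∑ y, (F.below r (r α)).bias T y * (F.link r α).bias T (y - u) := by
  unfold cross
  rw [bias_update (notMem_of_mem_below le_rfl), bias_update (notMem_of_mem_link le_rfl),
    update_self]

theorem cross_sq_le :
    F.cross r α T ^ 2 ≤ 4 * ((F.below r (r α)).energy T * (F.link r α).energy T) := by
  unfold cross
  rw [mul_pow]
  have h : ∑ y, (F.link r α).bias T (y - T α) ^ 2 = (F.link r α).energy T :=
    Fintype.sum_equiv (Equiv.subRight (T α)) _ _ fun y => rfl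
  have := Finset.sum_mul_sq_le_sq_mul_sq Finset.univ ((F.below r (r α)).bias T)
    (fun y => (F.link r α).bias T (y - T α))
  rw [h] at this
  unfold energy at this ⊢
  linarith

theorem sum_cross_update : ∑ u, F.cross r α (update T α u) = 0 := by
  simp only [cross_update_self]
  rw [← Finset.mul_sum, Finset.sum_comm]
  have h (y : HashValue ℓ) : ∑ u, (F.link r α).bias T (y - u) = 0 := by
    rw [← sum_bias (F.link r α) T]
    exact Fintype.sum_equiv (Equiv.subLeft y) _ _ fun u => rfl
  simp_rw [← Finset.mul_sum, h]
  simp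

/-- As a function of the new entry, the cross term is a correlation of the earlier deviations, which
have mean zero, with a translate of the link. -/
theorem sum_cross_update_sq_le {G : ℝ} (hG : ∀ a ≠ 0, (F.link r α).coeff T a ^ 2 ≤ G) :
    ∑ u, F.cross r α (update T α u) ^ 2 ≤ 4 * (G * (F.below r (r α)).energy T) := by
  simp only [cross_update_self, mul_pow]
  rw [← Finset.mul_sum]
  have := sum_correlation_sq_le (sum_bias (F.below r (r α)) T)
    (fun a ha => (walsh_bias (F.link r α) T ha).symm ▸ hG a ha)
  unfold energy
  linarith

end Cross

/-- With high probability, the energy is at most a constant times the mass. -/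
theorem fraction_energy_le (c : ℕ) : ∀ γ : ℝ, 0 < γ → ∃ D : ℝ, 1 ≤ D ∧ ∀ᶠ ℓ : ℕ in atTop,
    ∀ (I : Type*) [Fintype I] [DecidableEq I] (r : I → ℕ), Injective r →
    ∀ F : WeightedKeys I ℓ, (∀ x ∈ F.keys, x.card ≤ c) →
      fraction (fun T => D * F.mass < F.energy T) ≤ F.keys.card / binCount ℓ ^ γ := by
  classical
  induction c with
  | zero =>
    intro γ hγ
    refine ⟨1, le_rfl, Eventually.of_forall fun ℓ I _ _ r hr F hF => ?_⟩
    rw [fraction_eq_zero]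
    · have := binCount_pos ℓ; positivity
    · intro T
      have := energy_le_mass (forall_eq_empty hF) T
      linarith
  | succ c ih =>
    intro γ hγ
    obtain ⟨D', hD', ih⟩ := ih (γ + 1) (by positivity)
    -- Freedman's exponent will be at least (q/16) log √m = (q/32) log m. The summand 4 ensures `D ≥
    -- 16 D'`, so that the starting energy and the link energies use up less than half of the
    -- target.
    obtain ⟨q, hq⟩ : ∃ q, q = 32 * (γ + 1) + 4 := ⟨_, rfl⟩
    have hq4 : 4 ≤ q := by rw [hq]; linarith
    -- With this form, the Cauchy–Schwarz bound 2 √(D D') W on a cross term is exactly 2 W D' q.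
    obtain ⟨D, hD⟩ : ∃ D, D = D' * q ^ 2 := ⟨_, rfl⟩
    have hD16 : 16 * D' ≤ D := by
      have : 16 ≤ q ^ 2 := by nlinarith
      rw [hD]; nlinarith
    refine ⟨D, by linarith, ?_⟩
    filter_upwards [ih, fraction_coeff_le c (γ + 1) (1 / 2) (by norm_num),
      tendsto_binCount.eventually_ge_atTop 4] with ℓ ih hcoeff hm I _ _ r hr F hF
    have hm0 := binCount_pos ℓ
    set m := binCount ℓ with hmdef
    obtain ⟨X, hX⟩ : ∃ X, X = m ^ (1 / 2 : ℝ) := ⟨_, rfl⟩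
    have hX0 : 0 < X := by rw [hX]; positivity
    have hXX : X * X = m := by
      rw [hX, ← Real.rpow_add hm0]; norm_num
    rw [← hX] at hcoeff
    rcases F.mass_nonneg.eq_or_lt with hW | hW
    · rw [fraction_eq_zero]
      · positivity
      · intro T
        simp [energy, bias_eq_zero hW.symm, ← hW]
    obtain ⟨W, hWdef⟩ : ∃ W, W = F.mass := ⟨_, rfl⟩
    have hk := one_le_card hW
    rw [← hWdef] at hW ⊢
    have hD0 : 0 < D := by linarith
    have hD'0 : 0 < D' := by linarith
    have hq0 : 0 < q := by linarith
    obtain ⟨t, ht⟩ : ∃ t, t = D * W / 2 := ⟨_, rfl⟩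
    -- Asking for all ranks up to `r α` makes this a stopping rule: once the energy has exceeded its
    -- target, every later term is dropped.
    let good : I → (I → HashValue ℓ) → Prop := fun α T =>
      (F.link r α).energy T ≤ D' * (F.link r α).mass ∧
      (∀ a ≠ 0, (F.link r α).coeff T a ^ 2 ≤ X * (F.link r α).mass) ∧
      ∀ k ≤ r α, (F.below r k).energy T ≤ D * W
    have key : fraction (fun T => t ≤ |∑ α, if good α T then F.cross r α T else 0|) ≤
        2 * (1 / m ^ (γ + 1)) := by
      refine (fraction_stopped_sum_le hr (F.cross r) good
        (fun α => 4 / X * (F.link r α).mass * (D * W)) (M := 2 * W * D' * q)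
        (V := 4 / X * D * W ^ 2) (by positivity) (by positivity) (by rw [ht]; positivity)
        ?_ ?_ ?_ ?_ ?_ ?_ ?_).trans ?_
      · exact fun α => mul_nonneg (mul_nonneg (by positivity) (mass_nonneg _)) (by positivity)
      · intro α β T u h
        have hne : β ≠ α := by rintro rfl; exact h.false
        unfold cross
        rw [bias_update (notMem_of_mem_below h.le), bias_update (notMem_of_mem_link h.le),
          update_of_ne hne]
      · intro α β T u h
        simp only [good, coeff_update (notMem_of_mem_link h), energy_update (notMem_of_mem_link h)]
        refine and_congr Iff.rfl (and_congr Iff.rfl (forall₂_congr fun k hk => ?_))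
        rw [energy_update (notMem_of_mem_below (hk.trans h))]
      · rintro α T ⟨h1, -, h3⟩
        refine abs_le_of_sq_le_sq ((F.cross_sq_le r α T).trans ?_) (by positivity)
        calc 4 * ((F.below r (r α)).energy T * (F.link r α).energy T)
            ≤ 4 * ((D * W) * (D' * W)) := by
              gcongr
              · exact energy_nonneg _ _
              · exact h3 _ le_rfl
              · refine h1.trans ?_
                rw [hWdef]
                gcongr
                exact F.mass_link_le hr α
          _ = _ := by rw [hD]; ring
      · exact fun α T _ => F.sum_cross_update r α T
      · rintro α T ⟨-, h2, h3⟩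
        refine (F.sum_cross_update_sq_le r α T h2).trans ?_
        change _ ≤ m * _
        calc 4 * (X * (F.link r α).mass * (F.below r (r α)).energy T)
            ≤ 4 * (X * (F.link r α).mass * (D * W)) := by
              have := (F.link r α).mass_nonneg
              gcongr
              exact h3 _ le_rfl
          _ = _ := by rw [← hXX]; field_simp
      · rw [← Finset.sum_mul, ← Finset.mul_sum]
        have := F.sum_mass_link_le hr
        rw [← hWdef] at this
        calc 4 / X * (∑ α, (F.link r α).mass) * (D * W) ≤ 4 / X * W * (D * W) := by gcongr
          _ = _ := by ring
      · gcongr 2 * ?_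
        refine le_trans ?_ (exp_neg_mul_log_le (a := q / 32) (by linarith) (by rw [hq]; linarith))
        gcongr Real.exp (-?_)
        have h1 : t / (4 * (2 * W * D' * q)) = q / 16 := by
          rw [ht, hD]; field_simp; norm_num
        have h2 : t * (2 * W * D' * q) / (4 / X * D * W ^ 2) = D' * q * X / 4 := by
          rw [ht]; field_simp
        rw [h1, h2]
        have h3 : Real.log m = 2 * Real.log X := by
          rw [← hXX, Real.log_mul hX0.ne' hX0.ne']; ring
        have h4 : Real.log X ≤ Real.log (1 + D' * q * X / 4) := by
          refine Real.log_le_log hX0 ?_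
          have : 4 ≤ D' * q := by nlinarith
          nlinarith
        rw [h3]
        nlinarith
    calc fraction (fun T => D * W < F.energy T)
        ≤ fraction (fun T => ((∃ α ∈ Finset.univ, D' * (F.link r α).mass < (F.link r α).energy T) ∨
            (∃ α ∈ Finset.univ, ∃ a ≠ 0, X * (F.link r α).mass < (F.link r α).coeff T a ^ 2)) ∨
            t ≤ |∑ α, if good α T then F.cross r α T else 0|) := by
          refine fraction_mono fun T hT => ?_
          rw [or_iff_not_imp_left]
          intro hgood
          push Not at hgood
          obtain ⟨h1, h2⟩ := hgood
          -- At the first rank `k` with excessive energy, the good positions are exactly those below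
          -- `k`, so the stopped sum is the sum of cross terms that caused the excess.
          have hex : ∃ k, D * W < (F.below r k).energy T := by
            obtain ⟨k, -, hFk⟩ := F.exists_below_eq r
            exact ⟨k, hFk.symm ▸ hT⟩
          have hk1 := Nat.find_spec hex
          have hk2 : ∀ k < Nat.find hex, (F.below r k).energy T ≤ D * W :=
            fun k hk => not_lt.1 (Nat.find_min hex hk)
          set k := Nat.find hex
          have hsum : ∑ α, (if good α T then F.cross r α T else 0) =
              ∑ α with r α < k, F.cross r α T := by
            rw [Finset.sum_filter]
            refine Finset.sum_congr rfl fun α _ => if_congr ?_ rfl rfl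
            constructor
            · rintro ⟨-, -, h3⟩
              by_contra hlt
              exact (hk1.trans_le (h3 k (not_lt.1 hlt))).false
            · exact fun hlt => ⟨h1 α (Finset.mem_univ _), fun a ha => h2 α (Finset.mem_univ _) a ha,
                fun k' hk' => hk2 k' (hk'.trans_lt hlt)⟩
          have h3 := F.energy_below hr k T
          rw [Finset.sum_add_distrib] at h3
          have h4 := (energy_le_mass forall_mem_below_zero T).trans (F.mass_below_le r 0)
          have h5 : ∑ α with r α < k, (F.link r α).energy T ≤ D' * W := by
            calc ∑ α with r α < k, (F.link r α).energy T
                ≤ ∑ α, (F.link r α).energy T :=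
                  Finset.sum_le_sum_of_subset_of_nonneg (Finset.filter_subset _ _)
                    fun _ _ _ => energy_nonneg _ _
              _ ≤ ∑ α, D' * (F.link r α).mass :=
                  Finset.sum_le_sum fun α _ => h1 α (Finset.mem_univ _)
              _ ≤ D' * W := by
                  rw [← Finset.mul_sum, hWdef]
                  gcongr
                  exact F.sum_mass_link_le hr
          rw [hsum]
          refine le_trans ?_ (le_abs_self _)
          have h6 : ∑ α with r α < k, F.cross r α T = (F.below r k).energy T -
              (F.below r 0).energy T - ∑ α with r α < k, (F.link r α).energy T := by
            rw [h3]; simp only [cross]; ring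
          rw [h6, ht]
          rw [← hWdef] at h4
          nlinarith
      _ ≤ (F.keys.card / m ^ (γ + 1) + F.keys.card / m ^ (γ + 1)) + 2 * (1 / m ^ (γ + 1)) := by
          refine (fraction_or_le _ _).trans (add_le_add ((fraction_or_le _ _).trans
            (add_le_add ?_ ?_)) key)
          · exact F.fraction_exists_link_le hr _ (by positivity)
              fun α => ih I r hr _ (card_le_of_mem_link hF)
          · exact F.fraction_exists_link_le hr _ (by positivity)
              fun α => hcoeff I r hr _ (card_le_of_mem_link hF)
      _ ≤ 4 * F.keys.card / m ^ (γ + 1) := by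
          rw [mul_one_div, ← add_div, ← add_div]
          gcongr
          linarith
      _ ≤ _ := four_mul_div_rpow_le hm (by positivity) γ

/-! ### Deviations of the bins -/

/-- The tail of the deviation of a bin, on the event that the links have bounded energy and
deviations. -/
theorem fraction_sum_link_bias_le [Fintype I] [DecidableEq I] {r : I → ℕ} (hr : Injective r)
    (F : WeightedKeys I ℓ) (y : HashValue ℓ) {D M V t : ℝ} (hD : 0 < D) (hM : 0 < M) (hV : 0 < V)
    (ht : 0 < t) (hmass : D / binCount ℓ * F.mass ≤ V) :
    fraction (fun T => (∀ α, (F.link r α).energy T ≤ D * (F.link r α).mass ∧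
        ∀ z, |(F.link r α).bias T z| ≤ M) ∧ t ≤ |∑ α, (F.link r α).bias T (y - T α)|) ≤
      2 * Real.exp (-(t / (4 * M) * Real.log (1 + t * M / V))) := by
  have hm0 := binCount_pos ℓ
  refine fraction_martingale_le hr (fun α T => (F.link r α).bias T (y - T α)) _
    (fun α => D / binCount ℓ * (F.link r α).mass) hM hV ht ?_ ?_ ?_ ?_ ?_ ?_ ?_
  · exact fun α => mul_nonneg (by positivity) (mass_nonneg _)
  · intro α β T u h
    have hne : β ≠ α := by rintro rfl; exact h.false
    simp only [bias_update (notMem_of_mem_link h.le), update_of_ne hne]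
  · intro α β T u h
    simp only [bias_update (notMem_of_mem_link h), energy_update (notMem_of_mem_link h)]
  · exact fun α T h => h.2 _
  · intro α T _
    simp only [bias_update (notMem_of_mem_link le_rfl), update_self]
    rw [← sum_bias (F.link r α) T]
    exact Fintype.sum_equiv (Equiv.subLeft y) _ _ fun u => rfl
  · intro α T h
    simp only [bias_update (notMem_of_mem_link le_rfl), update_self]
    have h1 : ∑ u, (F.link r α).bias T (y - u) ^ 2 = (F.link r α).energy T :=
      Fintype.sum_equiv (Equiv.subLeft y) _ _ fun u => rfl
    rw [h1]
    refine h.1.trans_eq ?_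
    change _ = binCount ℓ * _
    field_simp
  · rw [← Finset.mul_sum]
    refine le_trans ?_ hmass
    gcongr
    exact F.sum_mass_link_le hr

/-- If the total squared weight is well below the number of bins, then with high probability
the deviations of all bins are bounded by a constant. -/
theorem fraction_bias_le (c : ℕ) : ∀ γ ε : ℝ, 0 < γ → 0 < ε →
    ∃ M : ℝ, 1 ≤ M ∧ ∀ᶠ ℓ : ℕ in atTop,
    ∀ (I : Type*) [Fintype I] [DecidableEq I] (r : I → ℕ), Injective r →
    ∀ F : WeightedKeys I ℓ, (∀ x ∈ F.keys, x.card ≤ c) → (∀ x ∈ F.keys, |F.wt x| ≤ 1) →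
      F.mass ≤ binCount ℓ ^ (1 - ε) →
      fraction (fun T => ∃ y, M < |F.bias T y|) ≤ F.keys.card / binCount ℓ ^ γ := by
  induction c with
  | zero =>
    intro γ ε hγ hε
    refine ⟨1, le_rfl, Eventually.of_forall fun ℓ I _ _ r hr F hF hw _ => ?_⟩
    rw [fraction_eq_zero]
    · have := binCount_pos ℓ; positivity
    · rintro T ⟨y, hy⟩
      have := abs_bias_le_one (forall_eq_empty hF) hw T y
      linarith
  | succ c ih =>
    intro γ ε hγ hε
    obtain ⟨M', hM', ih⟩ := ih (γ + 1) ε (by positivity) hε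
    obtain ⟨D, hD, hB⟩ := fraction_energy_le c (γ + 1) (by positivity)
    -- The first summand makes the exponent (q/4) ε log m suffice for a union bound over the `m`
    -- bins; the second gives q/D ≥ 1 inside the logarithm.
    obtain ⟨q, hq⟩ : ∃ q, q = 4 * (γ + 2) / ε + D := ⟨_, rfl⟩
    have hq0 : D ≤ q := by rw [hq]; have : 0 < 4 * (γ + 2) / ε := by positivity
                           linarith
    have hqε : γ + 2 ≤ q / 4 * ε := by
      rw [hq]
      have : (4 * (γ + 2) / ε + D) / 4 * ε = γ + 2 + D / 4 * ε := by field_simp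
      rw [this]
      have : 0 ≤ D / 4 * ε := by positivity
      linarith
    have ht0 : 1 ≤ M' * q := by nlinarith
    -- The extra 1 pays for the empty key, which belongs to no link.
    refine ⟨M' * q + 1, by linarith, ?_⟩
    filter_upwards [ih, hB, tendsto_binCount.eventually_ge_atTop 4]
      with ℓ ih hB hm I _ _ r hr F hF hw hmass
    have hm0 := binCount_pos ℓ
    have hm1 : 1 ≤ binCount ℓ := by linarith
    set m := binCount ℓ with hmdef
    rcases F.mass_nonneg.eq_or_lt with hW | hW
    · rw [fraction_eq_zero]
      · positivity
      · rintro T ⟨y, hy⟩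
        rw [bias_eq_zero hW.symm, abs_zero] at hy
        linarith
    have hk := one_le_card hW
    have hD0 : 0 < D := by linarith
    have hM'0 : 0 < M' := by linarith
    have hlw (α : I) : ∀ x ∈ (F.link r α).keys, |(F.link r α).wt x| ≤ 1 :=
      fun x hx => hw _ (mem_link.1 hx).1
    have key (y : HashValue ℓ) : fraction (fun T => (∀ α, (F.link r α).energy T ≤
        D * (F.link r α).mass ∧ ∀ z, |(F.link r α).bias T z| ≤ M') ∧
        M' * q ≤ |∑ α, (F.link r α).bias T (y - T α)|) ≤ 2 * (1 / m ^ (γ + 2)) := by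
      refine (F.fraction_sum_link_bias_le hr y (V := D * m ^ (-ε)) hD0 hM'0 (by positivity)
        (by linarith) ?_).trans ?_
      · calc D / m * F.mass ≤ D / m * m ^ (1 - ε) := by gcongr
          _ = D * m ^ (-ε) := by
              rw [sub_eq_add_neg, Real.rpow_add hm0, Real.rpow_one]
              field_simp
      · gcongr 2 * ?_
        refine le_trans ?_ (exp_neg_mul_log_le (a := q / 4 * ε) hm1 hqε)
        gcongr Real.exp (-?_)
        have h1 : M' * q / (4 * M') = q / 4 := by field_simp
        have h2 : M' * q * M' / (D * m ^ (-ε)) = M' * M' * (q / D) * m ^ ε := by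
          rw [Real.rpow_neg hm0.le]; field_simp
        rw [h1, h2, mul_assoc, ← Real.log_rpow hm0]
        have h3 : 1 ≤ q / D := (one_le_div hD0).2 hq0
        have h4 : 1 ≤ M' * M' * (q / D) := one_le_mul_of_one_le_of_one_le (by nlinarith) h3
        have h5 : 0 < m ^ ε := by positivity
        have : 0 ≤ q := by linarith
        gcongr
        nlinarith
    calc fraction (fun T => ∃ y, M' * q + 1 < |F.bias T y|)
        ≤ fraction (fun T => ((∃ α ∈ Finset.univ, D * (F.link r α).mass < (F.link r α).energy T) ∨
            (∃ α ∈ Finset.univ, ∃ z, M' < |(F.link r α).bias T z|)) ∨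
            ∃ y ∈ Finset.univ, (∀ α, (F.link r α).energy T ≤
              D * (F.link r α).mass ∧ ∀ z, |(F.link r α).bias T z| ≤ M') ∧
              M' * q ≤ |∑ α, (F.link r α).bias T (y - T α)|) := by
          refine fraction_mono fun T => ?_
          rintro ⟨y, hy⟩
          rw [or_iff_not_imp_left]
          intro hgood
          push Not at hgood
          refine ⟨y, Finset.mem_univ _, fun α => ⟨hgood.1 α (Finset.mem_univ _),
            hgood.2 α (Finset.mem_univ _)⟩, ?_⟩
          rw [F.bias_eq hr] at hy
          have h1 := abs_bias_le_one (F := F.below r 0) forall_mem_below_zero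
            (fun x hx => hw x (mem_keys_of_mem_below hx)) T y
          have h2 := abs_add_le ((F.below r 0).bias T y) (∑ α, (F.link r α).bias T (y - T α))
          linarith
      _ ≤ (F.keys.card / m ^ (γ + 1) + F.keys.card / m ^ (γ + 1)) +
            ∑ y : HashValue ℓ, 2 * (1 / m ^ (γ + 2)) := by
          refine (fraction_or_le _ _).trans (add_le_add ((fraction_or_le _ _).trans
            (add_le_add ?_ ?_)) ?_)
          · exact F.fraction_exists_link_le hr _ (by positivity)
              fun α => hB I r hr _ (card_le_of_mem_link hF)
          · exact F.fraction_exists_link_le hr _ (by positivity)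
              fun α => ih I r hr _ (card_le_of_mem_link hF) (hlw α)
                ((F.mass_link_le hr α).trans hmass)
          · exact (fraction_exists_le _ _).trans (Finset.sum_le_sum fun y _ => key y)
      _ = (F.keys.card / m ^ (γ + 1) + F.keys.card / m ^ (γ + 1)) + 2 * (1 / m ^ (γ + 1)) := by
          rw [Finset.sum_const, nsmul_eq_mul, Finset.card_univ]
          change _ + m * _ = _
          rw [show γ + 2 = (γ + 1) + 1 by ring, Real.rpow_add hm0 (γ + 1), Real.rpow_one]
          field_simp
      _ ≤ 4 * F.keys.card / m ^ (γ + 1) := by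
          rw [mul_one_div, ← add_div, ← add_div]
          gcongr
          linarith
      _ ≤ _ := four_mul_div_rpow_le hm (by positivity) γ

end WeightedKeys

/-! ### Orders of the positions with light links -/

/-- A set has at most `|J| ^ k` nonempty subsets of size at most `k`. -/
theorem card_le_pow_of_subset {I : Type*} [DecidableEq I] {k : ℕ} {J : Finset I}
    {S : Finset (Finset I)} (hS : ∀ x ∈ S, x.Nonempty ∧ x.card ≤ k ∧ x ⊆ J) :
    S.card ≤ J.card ^ k := by
  have hsub : S ⊆ (Fintype.piFinset fun _ : Fin k => J).image fun f => Finset.univ.image f := by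
    intro x hx
    obtain ⟨hne, hk, hJ⟩ := hS x hx
    have : Nonempty x := hne.to_subtype
    obtain ⟨e⟩ := Function.Embedding.nonempty_of_card_le (α := x) (β := Fin k) (by simpa using hk)
    refine Finset.mem_image.2 ⟨fun i => (invFun e i : x), ?_, ?_⟩
    · exact Fintype.mem_piFinset.2 fun i => hJ (invFun e i).2
    · ext β
      simp only [Finset.mem_image, Finset.mem_univ, true_and]
      constructor
      · rintro ⟨i, rfl⟩
        exact (invFun e i).2
      · intro hβ
        obtain ⟨i, hi⟩ := invFun_surjective e.injective ⟨β, hβ⟩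
        exact ⟨i, by rw [hi]⟩
  refine (Finset.card_le_card hsub).trans (Finset.card_image_le.trans ?_)
  simp

namespace WeightedKeys

variable {I : Type*} {ℓ : ℕ}

/-- The family with all weights multiplied by `s`. -/
def scale (F : WeightedKeys I ℓ) (s : ℝ) : WeightedKeys I ℓ where
  keys := F.keys
  shift := F.shift
  wt := fun x => s * F.wt x

theorem bias_scale (F : WeightedKeys I ℓ) (s : ℝ) (T : I → HashValue ℓ) (y : HashValue ℓ) :
    (F.scale s).bias T y = s * F.bias T y := by
  simp only [bias, scale, Finset.mul_sum, mul_assoc]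
  rfl

theorem mass_scale (F : WeightedKeys I ℓ) (s : ℝ) : (F.scale s).mass = s ^ 2 * F.mass := by
  simp only [mass, scale, Finset.mul_sum, mul_pow]

section Rank

variable [DecidableEq I] (F : WeightedKeys I ℓ) {k : ℕ}

/-- Let W_J be the mass of the keys inside `J`. By double counting, the lightest position of `J`
carries at most k W_J / |J|, and W_J ≤ |J|^k because weights are at most 1 in absolute value; hence
|J| ≥ W_J^(1/k). -/
theorem exists_mem_sum_le (hk : k ≠ 0)
    (hF : ∀ x ∈ F.keys, x.Nonempty ∧ x.card ≤ k) (hw : ∀ x ∈ F.keys, |F.wt x| ≤ 1)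
    {J : Finset I} (hJ : J.Nonempty) :
    ∃ α ∈ J, ∑ x ∈ F.keys with x ⊆ J ∧ α ∈ x, F.wt x ^ 2 ≤ k * F.mass ^ (1 - 1 / k : ℝ) := by
  obtain ⟨α, hα, hmin⟩ := J.exists_min_image
    (fun α => ∑ x ∈ F.keys with x ⊆ J ∧ α ∈ x, F.wt x ^ 2) hJ
  refine ⟨α, hα, ?_⟩
  set d := ∑ x ∈ F.keys with x ⊆ J ∧ α ∈ x, F.wt x ^ 2 with hd
  have hd0 : 0 ≤ d := Finset.sum_nonneg fun _ _ => sq_nonneg _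
  have hk1 : (1 : ℝ) ≤ k := by exact_mod_cast Nat.one_le_iff_ne_zero.2 hk
  have hk0 : (0 : ℝ) < k := by linarith
  have hJ0 : (0 : ℝ) < J.card := by exact_mod_cast hJ.card_pos
  obtain ⟨WJ, hWJ⟩ : ∃ WJ, WJ = ∑ x ∈ F.keys with x ⊆ J, F.wt x ^ 2 := ⟨_, rfl⟩
  have hWJ0 : 0 ≤ WJ := hWJ ▸ Finset.sum_nonneg fun _ _ => sq_nonneg _
  have h1 : J.card * d ≤ k * WJ := by
    calc J.card * d = ∑ _α ∈ J, d := by simp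
      _ ≤ ∑ α ∈ J, ∑ x ∈ F.keys with x ⊆ J ∧ α ∈ x, F.wt x ^ 2 := Finset.sum_le_sum hmin
      _ = ∑ x ∈ F.keys with x ⊆ J, x.card * F.wt x ^ 2 := by
          simp_rw [← Finset.filter_filter, Finset.sum_filter (fun x => _ ∈ x)]
          rw [Finset.sum_comm]
          refine Finset.sum_congr rfl fun x hx => ?_
          rw [← Finset.sum_filter, Finset.filter_mem_eq_inter,
            Finset.inter_eq_right.2 (Finset.mem_filter.1 hx).2]
          simp
      _ ≤ ∑ x ∈ F.keys with x ⊆ J, k * F.wt x ^ 2 := by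
          refine Finset.sum_le_sum fun x hx => ?_
          gcongr
          exact_mod_cast (hF x (Finset.mem_filter.1 hx).1).2
      _ = k * WJ := by rw [hWJ, Finset.mul_sum]
  have h2 : WJ ≤ (J.card : ℝ) ^ k := by
    calc WJ ≤ ∑ x ∈ F.keys with x ⊆ J, 1 := by
          rw [hWJ]
          refine Finset.sum_le_sum fun x hx => ?_
          rw [sq_le_one_iff_abs_le_one]
          exact hw x (Finset.mem_filter.1 hx).1
      _ = ((F.keys.filter fun x => x ⊆ J).card : ℝ) := by simp
      _ ≤ _ := by
          exact_mod_cast card_le_pow_of_subset fun x hx => ⟨(hF x (Finset.mem_filter.1 hx).1).1,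
            (hF x (Finset.mem_filter.1 hx).1).2, (Finset.mem_filter.1 hx).2⟩
  have h3 : WJ ^ (1 / k : ℝ) ≤ J.card := by
    calc WJ ^ (1 / k : ℝ) ≤ ((J.card : ℝ) ^ k) ^ (1 / k : ℝ) := by gcongr
      _ = J.card := by rw [one_div, Real.pow_rpow_inv_natCast hJ0.le hk]
  have hWJW : WJ ≤ F.mass := by
    rw [hWJ]
    exact Finset.sum_le_sum_of_subset_of_nonneg (Finset.filter_subset _ _)
      fun _ _ _ => sq_nonneg _
  have hexp : (0 : ℝ) ≤ 1 - 1 / k := by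
    rw [sub_nonneg, div_le_one hk0]; exact hk1
  have h4 : d ≤ k * WJ ^ (1 - 1 / k : ℝ) := by
    rcases hWJ0.eq_or_lt with h0 | h0
    · have : d ≤ 0 := by
        rw [← h0, mul_zero] at h1
        by_contra hcon
        push Not at hcon
        have := mul_pos hJ0 hcon
        linarith
      exact this.trans (mul_nonneg hk0.le (Real.rpow_nonneg hWJ0 _))
    · rw [Real.rpow_sub h0, Real.rpow_one, mul_div_assoc', le_div_iff₀ (Real.rpow_pos_of_pos h0 _)]
      calc d * WJ ^ (1 / k : ℝ) ≤ d * J.card := by gcongr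
        _ ≤ _ := by linarith
  exact h4.trans (by gcongr)

/-- Greedy choice: the lightest position of `J` comes last, and the rest is ordered recursively. A
key whose last position is an earlier one avoids it, so it lies inside the smaller set. -/
theorem exists_rank_on (hk : k ≠ 0)
    (hF : ∀ x ∈ F.keys, x.Nonempty ∧ x.card ≤ k) (hw : ∀ x ∈ F.keys, |F.wt x| ≤ 1) (n : ℕ) :
    ∀ J : Finset I, J.card = n → ∃ r : I → ℕ, Set.InjOn r J ∧ (∀ α ∈ J, r α < n) ∧
      ∀ α ∈ J, ∑ x ∈ F.keys with x ⊆ J ∧ α ∈ x ∧ ∀ β ∈ x, β ≠ α → r β < r α, F.wt x ^ 2 ≤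
        k * F.mass ^ (1 - 1 / k : ℝ) := by
  induction n with
  | zero =>
    intro J hJ
    rw [Finset.card_eq_zero] at hJ
    subst hJ
    exact ⟨fun _ => 0, by simp⟩
  | succ n ih =>
    intro J hJ
    obtain ⟨α₀, hα₀, hd⟩ := F.exists_mem_sum_le hk hF hw (Finset.card_pos.1 (by omega : 0 < J.card))
    obtain ⟨r, hinj, hlt, hr⟩ := ih (J.erase α₀) (by rw [Finset.card_erase_of_mem hα₀]; omega)
    have hr0 : update r α₀ n α₀ = n := update_self _ _ _
    have hr1 {β : I} (h : β ≠ α₀) : update r α₀ n β = r β := update_of_ne h _ _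
    have hlt' {β : I} (hβ : β ∈ J) (h : β ≠ α₀) : r β < n := hlt β (Finset.mem_erase.2 ⟨h, hβ⟩)
    refine ⟨update r α₀ n, ?_, ?_, ?_⟩
    · intro α hα β hβ h
      by_cases hα' : α = α₀ <;> by_cases hβ' : β = α₀
      · rw [hα', hβ']
      · rw [hα', hr0, hr1 hβ'] at h
        exact absurd h (hlt' hβ hβ').ne'
      · rw [hβ', hr0, hr1 hα'] at h
        exact absurd h (hlt' hα hα').ne
      · rw [hr1 hα', hr1 hβ'] at h
        exact hinj (by simpa [hα'] using hα) (by simpa [hβ'] using hβ) h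
    · intro α hα
      by_cases hα' : α = α₀
      · rw [hα', hr0]; omega
      · rw [hr1 hα']; exact (hlt' hα hα').trans (by omega)
    · intro α hα
      by_cases hα' : α = α₀
      · subst hα'
        refine le_trans (Finset.sum_le_sum_of_subset_of_nonneg ?_ fun _ _ _ => sq_nonneg _) hd
        intro x hx
        simp only [Finset.mem_filter] at hx ⊢
        exact ⟨hx.1, hx.2.1, hx.2.2.1⟩
      · refine le_trans (Finset.sum_le_sum_of_subset_of_nonneg ?_ fun _ _ _ => sq_nonneg _)
          (hr α (Finset.mem_erase.2 ⟨hα', hα⟩))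
        intro x hx
        simp only [Finset.mem_filter] at hx ⊢
        obtain ⟨hxF, hxJ, hαx, hlast⟩ := hx
        rw [hr1 hα'] at hlast
        have hnot : α₀ ∉ x := by
          intro hmem
          have h1 := hlast α₀ hmem (Ne.symm hα')
          rw [hr0] at h1
          exact absurd h1 (hlt' hα hα').le.not_gt
        refine ⟨hxF, Finset.subset_erase.2 ⟨hxJ, hnot⟩, hαx, fun β hβ hne => ?_⟩
        have h1 := hlast β hβ hne
        rwa [hr1 (by rintro rfl; exact hnot hβ)] at h1

/-- There is an order of the positions such that all links have a small mass. -/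
theorem exists_rank [Fintype I] (hk : k ≠ 0)
    (hF : ∀ x ∈ F.keys, x.Nonempty ∧ x.card ≤ k) (hw : ∀ x ∈ F.keys, |F.wt x| ≤ 1) :
    ∃ r : I → ℕ, Injective r ∧ ∀ α, (F.link r α).mass ≤ k * F.mass ^ (1 - 1 / k : ℝ) := by
  obtain ⟨r, hinj, -, hr⟩ := F.exists_rank_on hk hF hw _ Finset.univ rfl
  refine ⟨r, fun α β h => hinj (by simp) (by simp) h, fun α => ?_⟩
  have h := F.sum_link r α fun x => F.wt x ^ 2
  have h2 := hr α (Finset.mem_univ α)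
  simp only [Finset.subset_univ, true_and] at h2
  refine (h.le.trans (le_of_eq ?_)).trans h2
  congr!

end Rank

theorem bias_eq_sum_link [DecidableEq I] [Fintype I] {F : WeightedKeys I ℓ} {r : I → ℕ}
    (hr : Injective r) (hF : ∀ x ∈ F.keys, x.Nonempty) (T : I → HashValue ℓ) (y : HashValue ℓ) :
    F.bias T y = ∑ α, (F.link r α).bias T (y - T α) := by
  rw [F.bias_eq hr, add_eq_right]
  refine Finset.sum_eq_zero fun x hx => ?_
  have h1 := hF x (mem_keys_of_mem_below hx)
  rw [forall_mem_below_zero x hx] at h1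
  simp at h1

/-! ### Elementary inequalities -/

section Elementary

/-- Bernoulli's inequality (1 + x/D)^D ≥ 1 + x. -/
theorem log_one_add_div_ge {x D : ℝ} (hx : 0 ≤ x) (hD : 1 ≤ D) :
    1 / D * Real.log (1 + x) ≤ Real.log (1 + x / D) := by
  have hD0 : 0 < D := by linarith
  have h := one_add_mul_self_le_rpow_one_add (s := x / D) (by have := div_nonneg hx hD0.le; linarith)
    hD
  rw [mul_div_cancel₀ _ hD0.ne'] at h
  rw [one_div, inv_mul_le_iff₀ hD0, ← Real.log_rpow (by positivity)]
  exact Real.log_le_log (by positivity) h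

theorem half_le_log_one_add {x : ℝ} (hx : 0 ≤ x) (hx1 : x ≤ 1) : x / 2 ≤ Real.log (1 + x) := by
  rw [Real.le_log_iff_exp_le (by positivity)]
  have h := Real.exp_bound_div_one_sub_of_interval (x := x / 2) (by positivity) (by linarith)
  refine h.trans ?_
  rw [div_le_iff₀ (by linarith)]
  nlinarith

/-- If the light links still exceed m^(1-ε), then W is at least m^(1-ε)/k; taking k-th roots yields
m^(2ε), one factor m^ε more than the tail loses. -/
theorem rpow_div_le_rpow {k ε m W : ℝ} (hm : 0 < m) (hk : 1 ≤ k) (hW : 0 < W)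
    (hε : (1 - ε) * (1 / k) = 2 * ε) (hkm : k < m ^ (1 - ε))
    (h : m ^ (1 - ε) ≤ k * W ^ (1 - 1 / k)) : m ^ (2 * ε) / k ≤ W ^ (1 / k) := by
  have hk0 : 0 < k := by linarith
  have hW1 : 1 ≤ W := by
    by_contra hcon
    push Not at hcon
    have h2 : W ^ (1 - 1 / k) ≤ 1 := Real.rpow_le_one hW.le hcon.le
      (sub_nonneg.2 ((div_le_one hk0).2 hk))
    nlinarith
  have h3 : m ^ (1 - ε) / k ≤ W := by
    rw [div_le_iff₀ hk0]
    have h5 : 0 < 1 / k := by positivity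
    have h4 : W ^ (1 - 1 / k) ≤ W ^ (1 : ℝ) :=
      Real.rpow_le_rpow_of_exponent_le hW1 (by linarith)
    rw [Real.rpow_one] at h4
    nlinarith
  calc m ^ (2 * ε) / k ≤ m ^ (2 * ε) / k ^ (1 / k) := by
        gcongr
        calc k ^ (1 / k) ≤ k ^ (1 : ℝ) := Real.rpow_le_rpow_of_exponent_le hk
              ((div_le_one hk0).2 hk)
          _ = k := Real.rpow_one k
    _ = (m ^ (1 - ε) / k) ^ (1 / k) := by
        rw [Real.div_rpow (by positivity) hk0.le, ← Real.rpow_mul hm.le, hε]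
    _ ≤ _ := by gcongr

theorem div_mul_rpow_eq {k ε m W M D : ℝ} (hm : 0 < m) (hk : 0 < k) (hW : 0 < W) (hM : 0 < M) :
    D / m * W / (4 * M ^ 2 * (k * W ^ (1 - 1 / k) / m ^ (1 - ε))) =
      D / (4 * M ^ 2 * k) * (W ^ (1 / k) * m ^ (-ε)) := by
  have h5 : W ^ (1 - 1 / k) = W / W ^ (1 / k) := by
    rw [Real.rpow_sub hW, Real.rpow_one]
  have h6 : m ^ (1 - ε) = m * m ^ (-ε) := by
    rw [sub_eq_add_neg, Real.rpow_add hm, Real.rpow_one]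
  rw [h5, h6]
  have : 0 < W ^ (1 / k) := by positivity
  have : 0 < m ^ (-ε) := by positivity
  field_simp

end Elementary

/-! ### Concentration of a single bin -/

set_option maxHeartbeats 1000000 in
/-- Strong concentration of the weight of a bin when there are many bins. -/
theorem eventually_fraction_bias_ge_le (c : ℕ) (γ : ℝ) (hγ : 0 < γ) :
    ∃ κ : ℝ, 0 < κ ∧ ∀ᶠ ℓ : ℕ in atTop,
    ∀ (I : Type*) [Fintype I] [DecidableEq I] (F : WeightedKeys I ℓ),
      (∀ x ∈ F.keys, x.Nonempty ∧ x.card ≤ c + 1) → (∀ x ∈ F.keys, |F.wt x| ≤ 1) →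
      ∀ (y : HashValue ℓ) (t : ℝ), 0 < t → fraction (fun T => t ≤ |F.bias T y|) ≤
        2 * Real.exp (-(κ * (t * Real.log (1 + t * binCount ℓ / F.mass)))) +
          F.keys.card / binCount ℓ ^ γ := by
  obtain ⟨k, hk⟩ : ∃ k : ℝ, k = (c + 1 : ℕ) := ⟨_, rfl⟩
  have hk1 : 1 ≤ k := by rw [hk]; push_cast; linarith [(Nat.cast_nonneg c : (0 : ℝ) ≤ c)]
  have hk0 : 0 < k := by linarith
  -- The solution of (1 - ε)/k = 2ε.
  obtain ⟨ε, hε⟩ : ∃ ε, ε = 1 / (2 * k + 1) := ⟨_, rfl⟩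
  have hε0 : 0 < ε := by rw [hε]; positivity
  have hε1 : 0 < 1 - ε := by
    rw [hε, sub_pos, div_lt_one (by positivity)]; linarith
  have hεk : (1 - ε) * (1 / k) = 2 * ε := by rw [hε]; field_simp; ring
  obtain ⟨M, hM, hbias⟩ := fraction_bias_le c (γ + 1) ε (by positivity) hε0
  obtain ⟨D, hD, henergy⟩ := fraction_energy_le c (γ + 1) (by positivity)
  have hM0 : 0 < M := by linarith
  have hD0 : 0 < D := by linarith
  refine ⟨1 / (8 * M * D), by positivity, ?_⟩
  filter_upwards [hbias, henergy, tendsto_binCount.eventually_ge_atTop 4,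
    tendsto_binCount.eventually (eventually_le_rpow (k + 1) hε1),
    tendsto_binCount.eventually (eventually_mul_exp_neg_le
      (show 0 < D / (8 * M ^ 2 * k ^ 2) by positivity) hε0 2 (γ + 1))]
    with ℓ hbias henergy hm hmk hexp I _ _ F hF hw y t ht
  have hm0 := binCount_pos ℓ
  have hm1 : 1 ≤ binCount ℓ := by linarith
  set m := binCount ℓ with hmdef
  rcases F.mass_nonneg.eq_or_lt with hW | hW
  · rw [fraction_eq_zero]
    · positivity
    · intro T
      rw [bias_eq_zero hW.symm, abs_zero]
      linarith
  have hcard := one_le_card hW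
  obtain ⟨r, hr, hlink⟩ := F.exists_rank (k := c + 1) (by omega) hF hw
  rw [← hk] at hlink
  obtain ⟨W, hWdef⟩ : ∃ W, W = F.mass := ⟨_, rfl⟩
  rw [← hWdef] at hW hlink ⊢
  -- The factor by which the links may exceed the mass allowed in `fraction_bias_le`. Dividing the
  -- weights by θ, with θ² = max 1 U, restores that hypothesis and turns the deviation bound into M
  -- θ.
  set U := k * W ^ (1 - 1 / k) / m ^ (1 - ε) with hU
  obtain ⟨θ, hθ⟩ : ∃ θ, θ = √(max 1 U) := ⟨_, rfl⟩
  have hθ2 : θ ^ 2 = max 1 U := by rw [hθ, Real.sq_sqrt (by positivity)]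
  have hθ1 : 1 ≤ θ := by rw [hθ, Real.one_le_sqrt]; exact le_max_left _ _
  have hθ0 : 0 < θ := by linarith
  have hbias' (α : I) : fraction (fun T => ∃ z, M * θ < |(F.link r α).bias T z|) ≤
      (F.link r α).keys.card / m ^ (γ + 1) := by
    refine le_trans (fraction_mono ?_) (hbias I r hr ((F.link r α).scale θ⁻¹)
      (card_le_of_mem_link fun x hx => (hF x hx).2) ?_ ?_)
    · rintro T ⟨z, hz⟩
      refine ⟨z, ?_⟩
      rwa [bias_scale, abs_mul, abs_of_pos (inv_pos.2 hθ0), inv_mul_eq_div, lt_div_iff₀ hθ0]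
    · intro x hx
      simp only [scale]
      rw [abs_mul, abs_of_pos (inv_pos.2 hθ0)]
      exact mul_le_one₀ (inv_le_one_of_one_le₀ hθ1) (abs_nonneg _) (hw _ (mem_link.1 hx).1)
    · rw [mass_scale, inv_pow, inv_mul_le_iff₀ (by positivity), hθ2]
      calc (F.link r α).mass ≤ U * m ^ (1 - ε) := by
            rw [hU, div_mul_cancel₀ _ (by positivity)]; exact hlink α
        _ ≤ _ := by gcongr; exact le_max_right _ _
  have main (s : ℝ) (hs : 0 < s) : fraction (fun T => s ≤ |F.bias T y|) ≤
      2 * Real.exp (-(s / (4 * (M * θ)) * Real.log (1 + s * (M * θ) / (D / m * W)))) +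
        2 * F.keys.card / m ^ (γ + 1) := by
    calc fraction (fun T => s ≤ |F.bias T y|)
        ≤ fraction (fun T => ((∃ α ∈ Finset.univ, D * (F.link r α).mass < (F.link r α).energy T) ∨
            (∃ α ∈ Finset.univ, ∃ z, M * θ < |(F.link r α).bias T z|)) ∨
            (∀ α, (F.link r α).energy T ≤
              D * (F.link r α).mass ∧ ∀ z, |(F.link r α).bias T z| ≤ M * θ) ∧
              s ≤ |∑ α, (F.link r α).bias T (y - T α)|) := by
          refine fraction_mono fun T hT => ?_
          rw [or_iff_not_imp_left]
          intro hgood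
          push Not at hgood
          refine ⟨fun α => ⟨hgood.1 α (Finset.mem_univ _), hgood.2 α (Finset.mem_univ _)⟩, ?_⟩
          rwa [bias_eq_sum_link hr fun x hx => (hF x hx).1] at hT
      _ ≤ (F.keys.card / m ^ (γ + 1) + F.keys.card / m ^ (γ + 1)) +
            2 * Real.exp (-(s / (4 * (M * θ)) * Real.log (1 + s * (M * θ) / (D / m * W)))) := by
          refine (fraction_or_le _ _).trans (add_le_add ((fraction_or_le _ _).trans
            (add_le_add ?_ ?_)) ?_)
          · exact F.fraction_exists_link_le hr _ (by positivity)
              fun α => henergy I r hr _ (card_le_of_mem_link fun x hx => (hF x hx).2)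
          · exact F.fraction_exists_link_le hr _ (by positivity) hbias'
          · exact F.fraction_sum_link_bias_le hr y hD0 (by positivity) (by positivity) hs
              (by rw [hWdef])
      _ = _ := by ring
  have hfin : 4 * F.keys.card / m ^ (γ + 1) ≤ F.keys.card / m ^ γ :=
    four_mul_div_rpow_le hm (by positivity) γ
  have herr : 2 * F.keys.card / m ^ (γ + 1) ≤ F.keys.card / m ^ γ := by
    refine le_trans ?_ hfin
    gcongr
    norm_num
  have hlog0 : 0 ≤ Real.log (1 + t * m / W) := Real.log_nonneg (by
    have : 0 ≤ t * m / W := by positivity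
    linarith)
  have hM1D : 1 ≤ M * D := one_le_mul_of_one_le_of_one_le hM hD
  rcases le_total U 1 with hU1 | hU1
  · have hθone : θ = 1 := by rw [hθ, max_eq_left hU1, Real.sqrt_one]
    refine (main t ht).trans (add_le_add ?_ herr)
    rw [hθone, mul_one]
    gcongr 2 * Real.exp (-?_)
    have h1 := log_one_add_div_ge (x := t * m / W) (by positivity) hD
    have h2 : Real.log (1 + t * m / W / D) ≤ Real.log (1 + t * M / (D / m * W)) := by
      refine Real.log_le_log (by positivity) (add_le_add_right ?_ 1)
      rw [show t * m / W / D = t * 1 / (D / m * W) by field_simp]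
      gcongr
    calc 1 / (8 * M * D) * (t * Real.log (1 + t * m / W))
        = t / (8 * M) * (1 / D * Real.log (1 + t * m / W)) := by field_simp
      _ ≤ t / (4 * M) * Real.log (1 + t * M / (D / m * W)) := by
          have := h1.trans h2
          gcongr
          norm_num
  · have hθU : θ ^ 2 = U := by rw [hθ2, max_eq_right hU1]
    set V := D / m * W with hV
    have hV0 : 0 < V := by positivity
    -- For t ≤ V/(Mθ) Freedman's bound is Gaussian, and θ cancels from the exponent. For larger `t`,
    -- monotonicity reduces to V/(Mθ), where the exponent is already of order m^ε and the tail drops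
    -- into the additive error.
    rcases le_total (t * (M * θ)) V with htV | htV
    · refine (main t ht).trans (add_le_add ?_ herr)
      gcongr 2 * Real.exp (-?_)
      have h1 := half_le_log_one_add (x := t * (M * θ) / V) (by positivity)
        (div_le_one_of_le₀ htV hV0.le)
      have h2 : Real.log (1 + t * m / W) ≤ t * m / W := by
        have := Real.log_le_sub_one_of_pos (x := 1 + t * m / W) (by positivity)
        linarith
      calc 1 / (8 * M * D) * (t * Real.log (1 + t * m / W))
          ≤ 1 / (8 * 1 * D) * (t * (t * m / W)) := by gcongr
        _ = t / (4 * (M * θ)) * (t * (M * θ) / V / 2) := by rw [hV]; field_simp; norm_num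
        _ ≤ _ := by gcongr
    · have hs : 0 < V / (M * θ) := by positivity
      have hmono : fraction (fun T => t ≤ |F.bias T y|) ≤
          fraction (fun T => V / (M * θ) ≤ |F.bias T y|) := by
        refine fraction_mono fun T hT => le_trans ?_ hT
        rw [div_le_iff₀ (by positivity)]
        exact htV
      refine (hmono.trans (main _ hs)).trans ?_
      have h1 : V / (M * θ) * (M * θ) / V = 1 := by field_simp
      rw [h1]
      have hlog2 := half_le_log_one_add (x := 1) zero_le_one le_rfl
      have hUk : m ^ (1 - ε) ≤ k * W ^ (1 - 1 / k) := by
        rwa [hU, one_le_div (by positivity)] at hU1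
      have hq := rpow_div_le_rpow hm0 hk1 hW hεk (by linarith) hUk
      have hVθ : V / (M * θ) / (4 * (M * θ)) = D / (4 * M ^ 2 * k) * (W ^ (1 / k) * m ^ (-ε)) := by
        rw [div_div, show M * θ * (4 * (M * θ)) = 4 * M ^ 2 * θ ^ 2 by ring, hθU]
        exact div_mul_rpow_eq hm0 hk0 hW hM0
      have hexp2 : Real.exp (-(V / (M * θ) / (4 * (M * θ)) * Real.log (1 + 1))) ≤
          Real.exp (-(D / (8 * M ^ 2 * k ^ 2) * m ^ ε)) := by
        gcongr Real.exp (-?_)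
        rw [hVθ]
        calc D / (8 * M ^ 2 * k ^ 2) * m ^ ε
            = D / (4 * M ^ 2 * k) * (m ^ (2 * ε) / k * m ^ (-ε)) * (1 / 2) := by
              have : m ^ ε = m ^ (2 * ε) * m ^ (-ε) := by
                rw [← Real.rpow_add hm0]; congr 1; ring
              rw [this]
              field_simp
              norm_num
          _ ≤ _ := by gcongr
      calc 2 * Real.exp (-(V / (M * θ) / (4 * (M * θ)) * Real.log (1 + 1))) +
            2 * F.keys.card / m ^ (γ + 1)
          ≤ 1 / m ^ (γ + 1) + 2 * F.keys.card / m ^ (γ + 1) := by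
            gcongr
            linarith
        _ ≤ 4 * F.keys.card / m ^ (γ + 1) := by
            rw [← add_div]
            gcongr
            linarith
        _ ≤ F.keys.card / m ^ γ := hfin
        _ ≤ _ := le_add_of_nonneg_left (by positivity)

/-- Strong concentration of the weight of a bin. -/
theorem fraction_bias_ge_le (c : ℕ) (γ : ℝ) (hγ : 0 < γ) :
    ∃ K κ : ℝ, 0 < K ∧ 0 < κ ∧
    ∀ (I : Type*) [Fintype I] [DecidableEq I] (ℓ : ℕ) (F : WeightedKeys I ℓ),
      (∀ x ∈ F.keys, x.Nonempty ∧ x.card ≤ c + 1) → (∀ x ∈ F.keys, |F.wt x| ≤ 1) →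
      ∀ (y : HashValue ℓ) (t : ℝ), 0 < t → fraction (fun T => t ≤ |F.bias T y|) ≤
        K * Real.exp (-(κ * (t * Real.log (1 + t * binCount ℓ / F.mass)))) +
          F.keys.card / binCount ℓ ^ γ := by
  obtain ⟨κ, hκ, h⟩ := eventually_fraction_bias_ge_le c γ hγ
  obtain ⟨ℓ₀, h⟩ := eventually_atTop.1 h
  obtain ⟨B, hB⟩ : ∃ B, B = binCount ℓ₀ := ⟨_, rfl⟩
  have hB0 : 0 < B := hB ▸ binCount_pos _
  -- The exponential covers the finitely many small ℓ. Either the number of keys is at least m^γ and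
  -- the error term exceeds 1, or Cauchy–Schwarz gives t² ≤ nW, so t log(1 + tm/W) ≤ nm ≤ B^γ B.
  refine ⟨2 + Real.exp (κ * (B ^ γ * B)), κ, by positivity, hκ, ?_⟩
  intro I _ _ ℓ F hF hw y t ht
  rcases le_total ℓ₀ ℓ with hℓ | hℓ
  · refine (h ℓ hℓ I F hF hw y t ht).trans ?_
    gcongr
    linarith [Real.exp_pos (κ * (B ^ γ * B))]
  have hm0 := binCount_pos ℓ
  have hmB : binCount ℓ ≤ B := by
    rw [hB, binCount_eq, binCount_eq]
    exact pow_le_pow_right₀ (by norm_num) hℓ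
  set m := binCount ℓ with hmdef
  rcases le_total (m ^ γ) F.keys.card with hn | hn
  · refine (fraction_le_one _).trans ?_
    have : 1 ≤ F.keys.card / m ^ γ := (one_le_div (by positivity)).2 hn
    have : 0 ≤ (2 + Real.exp (κ * (B ^ γ * B))) *
      Real.exp (-(κ * (t * Real.log (1 + t * m / F.mass)))) := by positivity
    linarith
  by_cases hex : ∃ T, t ≤ |F.bias T y|
  swap
  · rw [fraction_eq_zero fun T hT => hex ⟨T, hT⟩]
    positivity
  obtain ⟨T, hT⟩ := hex
  have hW : 0 < F.mass := by
    refine F.mass_nonneg.lt_of_ne fun h0 => ?_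
    rw [bias_eq_zero h0.symm, abs_zero] at hT
    linarith
  have h1 : |F.bias T y| ≤ ∑ x ∈ F.keys, 1 * |F.wt x| := by
    refine (Finset.abs_sum_le_sum_abs _ _).trans (Finset.sum_le_sum fun x _ => ?_)
    rw [abs_mul, mul_comm]
    gcongr
    have h1 : m⁻¹ ≤ 1 := inv_le_one_of_one_le₀ (one_le_binCount ℓ)
    have h2 : 0 ≤ m⁻¹ := inv_nonneg.2 hm0.le
    rw [abs_le]
    split_ifs <;> constructor <;> linarith
  have h2 : t ^ 2 ≤ F.keys.card * F.mass := by
    have h3 := Finset.sum_mul_sq_le_sq_mul_sq F.keys (fun _ => (1 : ℝ)) (fun x => |F.wt x|)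
    simp only [sq_abs, one_pow, Finset.sum_const, nsmul_eq_mul, mul_one] at h3
    refine le_trans ?_ h3
    have := hT.trans h1
    gcongr
  have h3 : t * Real.log (1 + t * m / F.mass) ≤ B ^ γ * B := by
    have h4 : Real.log (1 + t * m / F.mass) ≤ t * m / F.mass := by
      have := Real.log_le_sub_one_of_pos (x := 1 + t * m / F.mass) (by positivity)
      linarith
    calc t * Real.log (1 + t * m / F.mass) ≤ t * (t * m / F.mass) := by gcongr
      _ = t ^ 2 * m / F.mass := by ring
      _ ≤ F.keys.card * F.mass * m / F.mass := by gcongr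
      _ = F.keys.card * m := by field_simp
      _ ≤ m ^ γ * m := by gcongr
      _ ≤ B ^ γ * B := by gcongr
  have h5 : 1 ≤ (2 + Real.exp (κ * (B ^ γ * B))) *
      Real.exp (-(κ * (t * Real.log (1 + t * m / F.mass)))) := by
    calc 1 = Real.exp (κ * (B ^ γ * B)) * Real.exp (-(κ * (B ^ γ * B))) := by
          rw [← Real.exp_add]; simp
      _ ≤ _ := by
          gcongr
          linarith
  refine (fraction_le_one _).trans ?_
  have : 0 ≤ F.keys.card / m ^ γ := by positivity
  linarith

end WeightedKeys

/-! ### Mean and variance under the uniform law -/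

theorem integral_uniformOn_coe {Ω : Type*} [MeasurableSpace Ω] [MeasurableSingletonClass Ω]
    (E : Finset Ω) (f : Ω → ℝ) : ∫ T, f T ∂(uniformOn (E : Set Ω)) = (∑ T ∈ E, f T) / E.card := by
  rw [uniformOn, ProbabilityTheory.cond, integral_smul_measure, setIntegral_finset]
  · simp [Measure.real, Measure.count_apply_finset, div_eq_inv_mul]
  · rw [← Set.biUnion_of_singleton (E : Set Ω)]
    exact (integrableOn_finite_biUnion E.finite_toSet).2 fun x _ => integrableOn_singleton
      (hx := by simp)

theorem real_uniformOn_coe {Ω : Type*} [MeasurableSpace Ω] [MeasurableSingletonClass Ω]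
    (E : Finset Ω) {B : Set Ω} [DecidablePred (· ∈ B)] (hB : MeasurableSet B) :
    (uniformOn (E : Set Ω)).real B = (∑ T ∈ E, if T ∈ B then (1 : ℝ) else 0) / E.card := by
  rw [← integral_indicator_one hB, integral_uniformOn_coe]
  simp [Set.indicator_apply]

theorem fraction_eq_sum {Ω : Type*} [Fintype Ω] (p : Ω → Prop) [DecidablePred p] :
    fraction p = (∑ T, if p T then (1 : ℝ) else 0) / Fintype.card Ω := by
  rw [fraction, Finset.card_filter]
  push_cast
  congr!

namespace WeightedKeys

variable {I : Type*} {ℓ : ℕ} [DecidableEq I]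

theorem hash_update_of_mem {F : WeightedKeys I ℓ} {x : Finset I} {α : I} (hα : α ∈ x)
    (V : I → HashValue ℓ) (u : HashValue ℓ) :
    F.hash (update V α u) x = u + (F.shift x + ∑ β ∈ x.erase α, V β) := by
  unfold hash
  rw [← Finset.add_sum_erase _ _ hα, update_self]
  have : ∑ β ∈ x.erase α, update V α u β = ∑ β ∈ x.erase α, V β :=
    Finset.sum_congr rfl fun β hβ => update_of_ne (Finset.ne_of_mem_erase hβ) _ _
  rw [this]
  abel

/-- The centered indicator of the event that the key `x` is hashed to the bin `y`. -/
noncomputable def hit (F : WeightedKeys I ℓ) (y : HashValue ℓ) (x : Finset I)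
    (V : I → HashValue ℓ) : ℝ := (if F.hash V x = y then 1 else 0) - (binCount ℓ)⁻¹

variable {F : WeightedKeys I ℓ} {x x' : Finset I} {α : I} (y : HashValue ℓ)

theorem sum_hit_update (hα : α ∈ x) (V : I → HashValue ℓ) :
    ∑ u, F.hit y x (update V α u) = 0 := by
  simp only [hit, hash_update_of_mem hα, ← eq_sub_iff_add_eq]
  rw [Finset.sum_sub_distrib, Finset.sum_ite_eq' Finset.univ, if_pos (Finset.mem_univ _),
    Finset.sum_const, Finset.card_univ, nsmul_eq_mul]
  exact sub_eq_zero.2 (mul_inv_cancel₀ (binCount_pos ℓ).ne').symm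

variable [Fintype I]

/-- Averaging over the entry at `α` alone already gives zero, since `x'` does not see it. -/
theorem sum_hit_mul_hit_of_mem (hα : α ∈ x) (hα' : α ∉ x') :
    ∑ V, F.hit y x V * F.hit y x' V = 0 := by
  refine (mul_eq_zero.1 ((sum_sum_update α
    (fun V : I → HashValue ℓ => F.hit y x V * F.hit y x' V)).symm.trans ?_)).resolve_left
    (binCount_pos ℓ).ne'
  refine Finset.sum_eq_zero fun V _ => ?_
  have h (u : HashValue ℓ) : F.hit y x' (update V α u) = F.hit y x' V := by
    simp only [hit, hash_update hα']
  simp_rw [h, ← Finset.sum_mul, sum_hit_update y hα, zero_mul]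

/-- Distinct sets differ in some position, so the centered indicators are orthogonal and the
variance is the sum over single keys. -/
theorem sum_hit_mul_hit (hne : x ≠ x') : ∑ V, F.hit y x V * F.hit y x' V = 0 := by
  by_cases h : x ⊆ x'
  · obtain ⟨α, hα, hα'⟩ := Finset.exists_of_ssubset (h.ssubset_of_ne hne)
    simp_rw [mul_comm (F.hit y x _)]
    exact sum_hit_mul_hit_of_mem y hα hα'
  · obtain ⟨α, hα, hα'⟩ := Finset.not_subset.1 h
    exact sum_hit_mul_hit_of_mem y hα hα'

theorem sum_hit (hx : x.Nonempty) : ∑ V, F.hit y x V = 0 := by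
  obtain ⟨α, hα⟩ := hx
  refine (mul_eq_zero.1 ((sum_sum_update α (F.hit y x)).symm.trans ?_)).resolve_left
    (binCount_pos ℓ).ne'
  exact Finset.sum_eq_zero fun V _ => sum_hit_update y hα V

theorem sum_hit_sq (hx : x.Nonempty) : ∑ V, F.hit y x V * F.hit y x V =
    Fintype.card (I → HashValue ℓ) * ((binCount ℓ)⁻¹ * (1 - (binCount ℓ)⁻¹)) := by
  have h (V : I → HashValue ℓ) : F.hit y x V * F.hit y x V =
      (1 - 2 * (binCount ℓ)⁻¹) * F.hit y x V + (binCount ℓ)⁻¹ * (1 - (binCount ℓ)⁻¹) := by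
    unfold hit
    split_ifs <;> ring
  simp_rw [h, Finset.sum_add_distrib, ← Finset.mul_sum, sum_hit y hx, mul_zero, zero_add,
    Finset.sum_const, Finset.card_univ, nsmul_eq_mul]
  ring

theorem sum_bias_tables (hF : ∀ x ∈ F.keys, x.Nonempty) : ∑ V, F.bias V y = 0 := by
  unfold bias
  rw [Finset.sum_comm]
  refine Finset.sum_eq_zero fun x hx => ?_
  rw [← Finset.mul_sum]
  exact mul_eq_zero_of_right _ (sum_hit y (hF x hx))

theorem sum_bias_sq_tables (hF : ∀ x ∈ F.keys, x.Nonempty) : ∑ V, F.bias V y ^ 2 =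
    Fintype.card (I → HashValue ℓ) * (F.mass * ((binCount ℓ)⁻¹ * (1 - (binCount ℓ)⁻¹))) := by
  have h (V : I → HashValue ℓ) : F.bias V y ^ 2 = ∑ x ∈ F.keys, ∑ x' ∈ F.keys,
      F.wt x * F.wt x' * (F.hit y x V * F.hit y x' V) := by
    rw [sq, bias, Finset.sum_mul_sum]
    refine Finset.sum_congr rfl fun x _ => Finset.sum_congr rfl fun x' _ => ?_
    unfold hit
    ring
  simp_rw [h]
  rw [Finset.sum_comm, mass, Finset.sum_mul, Finset.mul_sum]
  refine Finset.sum_congr rfl fun x hx => ?_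
  rw [Finset.sum_comm, Finset.sum_eq_single x]
  · rw [← Finset.mul_sum, sum_hit_sq y (hF x hx)]
    ring
  · intro x' _ hne
    rw [← Finset.mul_sum, sum_hit_mul_hit y hne.symm, mul_zero]
  · exact fun h => absurd hx h

end WeightedKeys

/-- Converts the exponent to the true variance v: 𝒞(x) ≤ x log(1 + x), and v ≥ W/(2m) for m ≥ 2,
where the factor 2 leaves the logarithm via 1 + 2x ≤ (1 + x)². For m = 1 the variance vanishes. -/
theorem mul_bennettC_le {W m t : ℝ} (hW : 0 ≤ W) (hm : 1 ≤ m) (ht : 0 < t) (hm2 : m = 1 ∨ 2 ≤ m) :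
    W * (m⁻¹ * (1 - m⁻¹)) * bennettC (t / (W * (m⁻¹ * (1 - m⁻¹)))) ≤
      2 * (t * Real.log (1 + t * m / W)) := by
  have hm0 : 0 < m := by linarith
  have hR : 0 ≤ 2 * (t * Real.log (1 + t * m / W)) := by
    have : 0 ≤ t * m / W := by positivity
    have := Real.log_nonneg (show 1 ≤ 1 + t * m / W by linarith)
    positivity
  rcases hm2 with rfl | hm2
  · simpa using hR
  rcases hW.eq_or_lt with h0 | hW
  · have : W * (m⁻¹ * (1 - m⁻¹)) = 0 := by rw [← h0, zero_mul]
    rw [this, zero_mul]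
    exact hR
  have hinv : m⁻¹ ≤ 2⁻¹ := inv_anti₀ (by norm_num) hm2
  obtain ⟨v, hv⟩ : ∃ v, v = W * (m⁻¹ * (1 - m⁻¹)) := ⟨_, rfl⟩
  have hv1 : W / (2 * m) ≤ v := by
    rw [hv]
    calc W / (2 * m) = W * (m⁻¹ * (1 - 2⁻¹)) := by field_simp; norm_num
      _ ≤ _ := by gcongr
  have hv0 : 0 < v := lt_of_lt_of_le (by positivity) hv1
  rw [← hv]
  have hx : 0 < t / v := by positivity
  have h1 : bennettC (t / v) ≤ t / v * Real.log (1 + t / v) := by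
    have := Real.log_le_sub_one_of_pos (x := t / v + 1) (by positivity)
    unfold bennettC
    rw [add_comm 1 (t / v)]
    linarith
  have h2 : Real.log (1 + t / v) ≤ 2 * Real.log (1 + t * m / W) := by
    rw [← Real.log_rpow (by positivity)]
    refine Real.log_le_log (by positivity) ?_
    have h3 : t / v ≤ 2 * (t * m / W) := by
      calc t / v ≤ t / (W / (2 * m)) := by gcongr
        _ = 2 * (t * m / W) := by field_simp
    norm_num
    have : 0 ≤ (t * m / W) ^ 2 := sq_nonneg _
    linarith [add_sq 1 (t * m / W)]
  calc v * bennettC (t / v) ≤ v * (t / v * Real.log (1 + t / v)) := by gcongr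
    _ = t * Real.log (1 + t / v) := by field_simp
    _ ≤ t * (2 * Real.log (1 + t * m / W)) := by gcongr
    _ = _ := by ring

/-! ### Tables with some entries held fixed -/

namespace CharTables

variable {c : ℕ} {A : Type*} {ℓ : ℕ}

instance : MeasurableSingletonClass (CharTables c A ℓ) := ⟨fun _ => trivial⟩

instance [Finite A] : Finite (CharTables c A ℓ) :=
  inferInstanceAs (Finite (Fin c → A → HashValue ℓ))

/-- Change the table entries outside of `Q` by the entries of `V`. -/
def translate (Q : Fin c → A → Prop) [∀ j a, Decidable (Q j a)] (T : CharTables c A ℓ)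
    (V : Fin c × A → HashValue ℓ) : CharTables c A ℓ :=
  fun j a => T j a + if Q j a then 0 else V (j, a)

variable (Q : Fin c → A → Prop) [∀ j a, Decidable (Q j a)] [DecidableEq A]

/-- The set of the position characters of the key `x` that are not in `Q`. -/
def freePart (x : Fin c → A) : Finset (Fin c × A) :=
  (Finset.univ.filter fun j => ¬ Q j (x j)).image fun j => (j, x j)

theorem mem_freePart {x : Fin c → A} {j : Fin c} {a : A} :
    (j, a) ∈ freePart Q x ↔ a = x j ∧ ¬ Q j a := by
  simp only [freePart, Finset.mem_image, Finset.mem_filter, Finset.mem_univ, true_and,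
    Prod.mk.injEq]
  constructor
  · rintro ⟨i, hi, rfl, rfl⟩
    exact ⟨rfl, hi⟩
  · rintro ⟨rfl, h⟩
    exact ⟨j, h, rfl, rfl⟩

theorem card_freePart_le (x : Fin c → A) : (freePart Q x).card ≤ c := by
  refine Finset.card_image_le.trans ((Finset.card_le_univ _).trans ?_)
  simp

/-- `Q` admits at most one character per coordinate, so a coordinate missing from the free part has
a known character. -/
theorem freePart_injective (hQ : ∀ j a b, Q j a → Q j b → a = b) : Injective (freePart Q) := by
  intro x x' h
  ext j
  by_cases h1 : Q j (x j)
  · by_cases h2 : Q j (x' j)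
    · exact hQ j _ _ h1 h2
    · have : (j, x' j) ∈ freePart Q x := h ▸ (mem_freePart Q).2 ⟨rfl, h2⟩
      exact ((mem_freePart Q).1 this).1.symm
  · have : (j, x j) ∈ freePart Q x' := h ▸ (mem_freePart Q).2 ⟨rfl, h1⟩
    exact ((mem_freePart Q).1 this).1

theorem simpleTabulation_translate (T : CharTables c A ℓ) (V : Fin c × A → HashValue ℓ)
    (x : Fin c → A) : simpleTabulation (translate Q T V) x =
      simpleTabulation T x + ∑ β ∈ freePart Q x, V β := by
  unfold simpleTabulation translate freePart
  rw [Finset.sum_add_distrib, Finset.sum_image (by intro i _ j _ h; exact congrArg Prod.fst h),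
    Finset.sum_filter]
  simp only [ite_not]

/-- The keys of `S` with a free position, seen as sets of free positions. -/
noncomputable def freeKeys (S : Finset (Fin c → A)) (w : (Fin c → A) → ℝ) (T : CharTables c A ℓ) :
    WeightedKeys (Fin c × A) ℓ where
  keys := (S.filter fun x => (freePart Q x).Nonempty).image (freePart Q)
  shift := extend (freePart Q) (simpleTabulation T) 0
  wt := extend (freePart Q) w 0

variable {Q} (hQ : ∀ j a b, Q j a → Q j b → a = b) (S : Finset (Fin c → A))
  (w : (Fin c → A) → ℝ) (T : CharTables c A ℓ)

theorem nonempty_of_mem_freeKeys {k : Finset (Fin c × A)} (hk : k ∈ (freeKeys Q S w T).keys) :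
    k.Nonempty ∧ k.card ≤ c := by
  obtain ⟨x, hx, rfl⟩ := Finset.mem_image.1 hk
  exact ⟨(Finset.mem_filter.1 hx).2, card_freePart_le Q x⟩

theorem card_freeKeys_le : (freeKeys Q S w T).keys.card ≤ S.card :=
  Finset.card_image_le.trans (Finset.card_filter_le _ _)

include hQ

theorem wt_freeKeys (x : Fin c → A) : (freeKeys Q S w T).wt (freePart Q x) = w x :=
  (freePart_injective Q hQ).extend_apply _ _ _

/-- The entries of `T` enter through the shift, and `V` plays the role of fresh random tables. -/
theorem hash_freeKeys (V : Fin c × A → HashValue ℓ) (x : Fin c → A) :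
    (freeKeys Q S w T).hash V (freePart Q x) = simpleTabulation (translate Q T V) x := by
  simp only [WeightedKeys.hash, freeKeys, (freePart_injective Q hQ).extend_apply,
    simpleTabulation_translate]

theorem mass_freeKeys : (freeKeys Q S w T).mass =
    ∑ x ∈ S with (freePart Q x).Nonempty, w x ^ 2 := by
  unfold WeightedKeys.mass
  change ∑ k ∈ (S.filter fun x => (freePart Q x).Nonempty).image (freePart Q), _ = _
  rw [Finset.sum_image (freePart_injective Q hQ).injOn]
  simp only [wt_freeKeys hQ]

/-- The centered weight of the keys with a free position in the bin `y`. -/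
theorem bias_freeKeys (V : Fin c × A → HashValue ℓ) (y : HashValue ℓ) :
    (freeKeys Q S w T).bias V y = ∑ x ∈ S with (freePart Q x).Nonempty,
      w x * ((if simpleTabulation (translate Q T V) x = y then 1 else 0) - (binCount ℓ)⁻¹) := by
  unfold WeightedKeys.bias
  change ∑ k ∈ (S.filter fun x => (freePart Q x).Nonempty).image (freePart Q), _ = _
  rw [Finset.sum_image (freePart_injective Q hQ).injOn]
  simp only [wt_freeKeys hQ, hash_freeKeys hQ]

omit hQ in
/-- Averaging over a translation-invariant set of tables. -/
theorem sum_translate [Fintype A] {E : Finset (CharTables c A ℓ)}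
    (hE : ∀ T ∈ E, ∀ V, translate Q T V ∈ E) (G : CharTables c A ℓ → ℝ) :
    ∑ T ∈ E, ∑ V, G (translate Q T V) =
      Fintype.card (Fin c × A → HashValue ℓ) * ∑ T ∈ E, G T := by
  rw [Finset.sum_comm]
  have hinv (T : CharTables c A ℓ) (V V' : Fin c × A → HashValue ℓ) (h : V + V' = 0) :
      translate Q (translate Q T V) V' = T := by
    funext j a
    have := congrFun h (j, a)
    simp only [Pi.add_apply, Pi.zero_apply] at this
    simp only [translate]
    split_ifs
    · simp
    · rw [add_assoc, this, add_zero]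
  have h (V : Fin c × A → HashValue ℓ) : ∑ T ∈ E, G (translate Q T V) = ∑ T ∈ E, G T :=
    Finset.sum_nbij' (fun T => translate Q T V) (fun T => translate Q T (-V))
      (fun T hT => hE T hT _) (fun T hT => hE T hT _)
      (fun T _ => hinv T _ _ (add_neg_cancel V)) (fun T _ => hinv T _ _ (neg_add_cancel V))
      (fun _ _ => rfl)
  simp [h]

/-- Concentration under the uniform distribution on a translation-invariant set of tables. -/
theorem stronglyConcentrated_uniformOn [Fintype A] {K κ γ : ℝ} (hκ : 0 < κ) (hK : 0 < K)
    {E : Finset (CharTables c A ℓ)} (hne : E.Nonempty) (hE : ∀ T ∈ E, ∀ V, translate Q T V ∈ E)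
    {y : HashValue ℓ} {C : ℝ}
    (hfixed : ∀ T ∈ E, ∑ x ∈ S with ¬ (freePart Q x).Nonempty,
      w x * (if simpleTabulation T x = y then 1 else 0) = C)
    (hw : ∀ x ∈ S, 0 ≤ w x ∧ w x ≤ 1)
    (hconc : ∀ (F : WeightedKeys (Fin c × A) ℓ), (∀ x ∈ F.keys, x.Nonempty ∧ x.card ≤ c) →
      (∀ x ∈ F.keys, |F.wt x| ≤ 1) → ∀ (y : HashValue ℓ) (t : ℝ), 0 < t →
        fraction (fun V => t ≤ |F.bias V y|) ≤
          K * Real.exp (-(κ * (t * Real.log (1 + t * binCount ℓ / F.mass)))) +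
            F.keys.card / binCount ℓ ^ γ) :
    StronglyConcentrated (uniformOn (E : Set (CharTables c A ℓ)))
      (fun T => binWeight S w y (simpleTabulation T)) K (κ / 2)
      ((S.card : ℝ) / ((2 ^ ℓ : ℕ) : ℝ) ^ γ) := by
  classical
  set S' := S.filter fun x => (freePart Q x).Nonempty with hS'
  set Y : CharTables c A ℓ → ℝ := fun T => ∑ x ∈ S',
      w x * ((if simpleTabulation T x = y then 1 else 0) - (binCount ℓ)⁻¹) with hY
  obtain ⟨W, hW⟩ : ∃ W, W = ∑ x ∈ S', w x ^ 2 := ⟨_, rfl⟩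
  have hW0 : 0 ≤ W := hW ▸ Finset.sum_nonneg fun _ _ => sq_nonneg _
  have hX (T : CharTables c A ℓ) (hT : T ∈ E) : binWeight S w y (simpleTabulation T) =
      Y T + ((∑ x ∈ S', w x) * (binCount ℓ)⁻¹ + C) := by
    rw [binWeight, ← Finset.sum_filter_add_sum_filter_not S fun x => (freePart Q x).Nonempty,
      hfixed T hT, hY]
    simp only [mul_sub, Finset.sum_sub_distrib, Finset.sum_mul]
    ring
  have hYbias (T : CharTables c A ℓ) (V : Fin c × A → HashValue ℓ) :
      Y (translate Q T V) = (freeKeys Q S w T).bias V y := (bias_freeKeys hQ S w T V y).symm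
  have hcard : (0 : ℝ) < E.card := by exact_mod_cast hne.card_pos
  have hcardV : (0 : ℝ) < Fintype.card (Fin c × A → HashValue ℓ) := by
    exact_mod_cast Fintype.card_pos
  have hYsum : ∑ T ∈ E, Y T = 0 := by
    refine (mul_eq_zero.1 ((sum_translate hE Y).symm.trans ?_)).resolve_left hcardV.ne'
    refine Finset.sum_eq_zero fun T _ => ?_
    simp only [hYbias]
    exact WeightedKeys.sum_bias_tables y fun x hx => (nonempty_of_mem_freeKeys S w T hx).1
  set σ := W * ((binCount ℓ)⁻¹ * (1 - (binCount ℓ)⁻¹)) with hσ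
  -- The free keys and their weights do not depend on `T`, so all orbits share the same second
  -- moment.
  have hYsq : ∑ T ∈ E, Y T ^ 2 = E.card * σ := by
    refine mul_left_cancel₀ hcardV.ne' ((sum_translate hE fun T => Y T ^ 2).symm.trans ?_)
    have h (T : CharTables c A ℓ) : ∑ V, Y (translate Q T V) ^ 2 =
        Fintype.card (Fin c × A → HashValue ℓ) * σ := by
      simp only [hYbias]
      rw [WeightedKeys.sum_bias_sq_tables y fun x hx => (nonempty_of_mem_freeKeys S w T hx).1,
        mass_freeKeys hQ, ← hW]
    simp only [h, Finset.sum_const, nsmul_eq_mul]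
    ring
  have hmean : ∫ T, binWeight S w y (simpleTabulation T) ∂(uniformOn (E : Set _)) =
      (∑ x ∈ S', w x) * (binCount ℓ)⁻¹ + C := by
    rw [integral_uniformOn_coe, Finset.sum_congr rfl hX, Finset.sum_add_distrib, hYsum]
    simp only [Finset.sum_const, nsmul_eq_mul, zero_add]
    field_simp
  have hvar : variance (fun T => binWeight S w y (simpleTabulation T))
      (uniformOn (E : Set (CharTables c A ℓ))) = σ := by
    rw [variance_eq_integral (measurable_from_top.aemeasurable), hmean,
      integral_uniformOn_coe, div_eq_iff hcard.ne', mul_comm σ, ← hYsq]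
    exact Finset.sum_congr rfl fun T hT => by rw [hX T hT, add_sub_cancel_right]
  intro t ht
  rw [hmean, hvar, real_uniformOn_coe E trivial]
  set R := K * Real.exp (-(κ / 2 * (σ * bennettC (t / σ)))) +
    (S.card : ℝ) / ((2 ^ ℓ : ℕ) : ℝ) ^ γ with hR
  have hm0 := binCount_pos ℓ
  have hm2 : binCount ℓ = 1 ∨ 2 ≤ binCount ℓ := by
    rw [binCount_eq]
    rcases Nat.eq_zero_or_pos ℓ with rfl | h
    · simp
    · refine Or.inr (le_self_pow₀ (by norm_num) h.ne')
  have hfrac (T : CharTables c A ℓ) : ∑ V, (if t ≤ |Y (translate Q T V)| then (1 : ℝ) else 0) ≤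
      Fintype.card (Fin c × A → HashValue ℓ) * R := by
    have h1 := hconc (freeKeys Q S w T) (fun x hx => nonempty_of_mem_freeKeys S w T hx) (by
      intro k hk
      obtain ⟨x, hx, rfl⟩ := Finset.mem_image.1 hk
      rw [wt_freeKeys hQ]
      have := hw x (Finset.mem_filter.1 hx).1
      rw [abs_of_nonneg this.1]
      exact this.2) y t ht
    rw [fraction_eq_sum, div_le_iff₀' hcardV] at h1
    simp only [hYbias]
    refine h1.trans ?_
    have h2 := mul_bennettC_le hW0 (one_le_binCount ℓ) ht hm2
    rw [← hσ] at h2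
    have h3 : ((2 ^ ℓ : ℕ) : ℝ) = binCount ℓ := by rw [binCount_eq]; push_cast; rfl
    rw [mass_freeKeys hQ, ← hW, hR, h3]
    have h4 := card_freeKeys_le (Q := Q) S w T
    have h5 : κ / 2 * (σ * bennettC (t / σ)) ≤
        κ * (t * Real.log (1 + t * binCount ℓ / W)) := by nlinarith
    gcongr
  rw [div_le_iff₀' hcard]
  refine le_of_mul_le_mul_left ?_ hcardV
  calc Fintype.card (Fin c × A → HashValue ℓ) * ∑ T ∈ E, (if T ∈ {T | t ≤
        |binWeight S w y (simpleTabulation T) - ((∑ x ∈ S', w x) * (binCount ℓ)⁻¹ + C)|}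
        then (1 : ℝ) else 0)
      = Fintype.card (Fin c × A → HashValue ℓ) * ∑ T ∈ E, (if t ≤ |Y T| then (1 : ℝ) else 0) := by
        congr 1
        refine Finset.sum_congr rfl fun T hT => ?_
        simp only [Set.mem_ofPred_eq, hX T hT, add_sub_cancel_right]
    _ = ∑ T ∈ E, ∑ V, (if t ≤ |Y (translate Q T V)| then (1 : ℝ) else 0) :=
        (sum_translate hE fun T => if t ≤ |Y T| then (1 : ℝ) else 0).symm
    _ ≤ ∑ _T ∈ E, Fintype.card (Fin c × A → HashValue ℓ) * R :=
        Finset.sum_le_sum fun T _ => hfrac T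
    _ = _ := by
        rw [Finset.sum_const, nsmul_eq_mul]
        ring

end CharTables

theorem theorem1 (c : ℕ) (hc : 1 ≤ c) (γ : ℝ) (hγ : 0 < γ) :
    ∃ K κ : ℝ, 0 < K ∧ 0 < κ ∧
      ∀ (A : Type*) [Fintype A] (ℓ : ℕ) (S : Finset (Fin c → A)) (w : (Fin c → A) → ℝ)
        (y : HashValue ℓ), (∀ x ∈ S, 0 ≤ w x ∧ w x ≤ 1) →
        StronglyConcentrated (tableMeasure c A ℓ)
            (fun T => binWeight S w y (simpleTabulation T)) K κ
            ((S.card : ℝ) / ((2 ^ ℓ : ℕ) : ℝ) ^ γ) ∧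
        HoldsForAllQueries (tableMeasure c A ℓ) simpleTabulation (fun P =>
          StronglyConcentrated P
            (fun T => binWeight S w y (simpleTabulation T)) K κ
            ((S.card : ℝ) / ((2 ^ ℓ : ℕ) : ℝ) ^ γ)) := by
  classical
  obtain ⟨c, rfl⟩ : ∃ k, c = k + 1 := ⟨c - 1, by omega⟩
  obtain ⟨K, κ, hK, hκ, h⟩ := WeightedKeys.fraction_bias_ge_le c γ hγ
  refine ⟨K, κ / 2, hK, by positivity, fun A _ ℓ S w y hw => ⟨?_, fun q z => ?_⟩⟩
  · have huniv : (((Set.toFinite (Set.univ : Set (CharTables (c + 1) A ℓ))).toFinset :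
        Finset (CharTables (c + 1) A ℓ)) : Set (CharTables (c + 1) A ℓ)) = Set.univ := by simp
    rw [tableMeasure, ← huniv]
    -- No entry is held fixed. Keys have at least one coordinate, so every key is free and the
    -- constant part is 0.
    refine CharTables.stronglyConcentrated_uniformOn (Q := fun _ _ => False) (by simp) S w hκ hK
      ((Set.Finite.toFinset_nonempty _).2 ⟨fun _ _ => 0, Set.mem_univ _⟩) (by simp) (C := 0) (fun T _ => ?_) hw (h _ ℓ)
    refine Finset.sum_eq_zero fun x hx => absurd ?_ (Finset.mem_filter.1 hx).2
    exact ⟨(0, x 0), (CharTables.mem_freePart _).2 ⟨rfl, id⟩⟩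
  · have hfib : (((Set.toFinite {T : CharTables (c + 1) A ℓ | simpleTabulation T q = z}).toFinset :
        Finset (CharTables (c + 1) A ℓ)) : Set (CharTables (c + 1) A ℓ)) =
        {T | simpleTabulation T q = z} := by simp
    have hcond : cond (tableMeasure (c + 1) A ℓ) {T | simpleTabulation T q = z} =
        uniformOn {T | simpleTabulation T q = z} := by
      have hmeas : MeasurableSet {T : CharTables (c + 1) A ℓ | simpleTabulation T q = z} := trivial
      rw [tableMeasure, uniformOn, uniformOn, cond_cond_eq_cond_inter MeasurableSet.univ hmeas,
        Set.univ_inter]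
    rw [hcond, ← hfib]
    -- Holding the entries of `q` fixed preserves the condition h(q) = z, and `q` is the only key
    -- without a free position.
    refine CharTables.stronglyConcentrated_uniformOn (Q := fun j a => a = q j)
      (fun j a b ha hb => ha.trans hb.symm) S w hκ hK
      ((Set.Finite.toFinset_nonempty _).2 ⟨fun j _ => if j = 0 then z else 0,
        show ∑ j : Fin (c + 1), (if j = 0 then z else 0) = z by simp⟩) (fun T hT V => ?_)
      (C := ∑ x ∈ S with ¬ (CharTables.freePart (fun j a => a = q j) x).Nonempty,
        w x * (if z = y then 1 else 0)) (fun T hT => ?_) hw (h _ ℓ)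
    · simp only [Set.Finite.mem_toFinset, Set.mem_ofPred_eq] at hT ⊢
      rw [CharTables.simpleTabulation_translate, hT, Finset.sum_eq_zero, add_zero]
      rintro ⟨j, a⟩ hβ
      obtain ⟨h1, h2⟩ := (CharTables.mem_freePart _).1 hβ
      exact absurd h1 h2
    · simp only [Set.Finite.mem_toFinset, Set.mem_ofPred_eq] at hT
      refine Finset.sum_congr rfl fun x hx => ?_
      have hxq : x = q := by
        ext j
        by_contra hne
        exact (Finset.mem_filter.1 hx).2 ⟨(j, x j), (CharTables.mem_freePart _).2 ⟨rfl, hne⟩⟩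
      rw [hxq, hT]
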